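/- **Theorem.** Let $n\ge 0$, let $E\subseteq\mathbb{R}^n$ be an arbitrary subset, $N:E\to\mathbb{S}^{n-1}$ a continuous mapping, $X$ a linear subspace of $\mathbb{R}^n$, and $P:\mathbb{R}^n\to X$ the orthogonal projection. A (possibly unbounded) *convex body* is a closed convex set $W\subseteq\mathbb{R}^n$ with nonempty interior. If $0\in\operatorname{int}(W)$, let $\mu_W(x)=\inf\{\lambda>0:\tfrac1\lambda x\in W\}$ be its Minkowski functional; $W$ is *of class $C^1$* if $\mu_W$ is of class $C^1$ on the open set $\mathbb{R}^n\setminus\mu_W^{-1}(0)$, and in that case $n_W(x)=\nabla\mu_W(x)/|\nabla\mu_W(x)|$, $x\in\partial W$, denotes the outer normal to $\partial W$. There exists a (possibly unbounded) convex body $W$ with $0\in\operatorname{int}(W)$ which is of class $C^1$ and satisfies $E\subseteq\partial W$, $N(x)=n_W(x)$ for all $x\in E$, and $X=\operatorname{span}(n_W(\partial W))$, if and only if the following four conditions hold: 1. $\langle N(y),x-y\rangle\le 0$ for all $x,y\in E$. 2. For all sequences $(x_k)_k,(z_k)_k$ in $E$ with $(P(x_k))_k$ bounded, $$\lim_{k\to\infty}\langle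 N(z_k),x_k-z_k\rangle=0\implies\lim_{k\to\infty}|N(z_k)-N(x_k)|=0.$$ 3. $0<\inf_{y\in E}\langle N(y),y\rangle$ (with $\inf\emptyset=+\infty$). 4. With $Y=\operatorname{span}(N(E))$, $d=\dim X$ and $\ell=\dim Y$, one has $Y\subseteq X$; and if $Y\ne X$ and $P_Y:\mathbb{R}^n\to Y$ is the orthogonal projection, then there exist linearly independent unit vectors $w_1,\dots,w_{d-\ell}\in X\cap Y^\perp$, points $p_1,\dots,p_{d-\ell}\in\mathbb{R}^n$ and a number $\varepsilon\in(0,1)$ such that $$\left(\overline{E}\cup\{0\}\right)\cap\bigcup_{j=1}^{d-\ell}V_j=\emptyset,\qquad V_j:=\{x\in\mathbb{R}^n:\ \varepsilon\langle w_j,x-p_j\rangle\ge|P_Y(x-p_j)|\}.$$ -/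

import Mathlib

open Set Filter Topology
open scoped InnerProductSpace Gradient

noncomputable section

/-- A (possibly unbounded) convex body: a closed convex set with nonempty interior. -/
structure IsConvexBody {n : ℕ} (W : Set (EuclideanSpace ℝ (Fin n))) : Prop where
  isClosed : IsClosed W
  convex : Convex ℝ W
  nonempty_interior : (interior W).Nonempty

/-- A convex body `W` with `0` in its interior is of class `C¹` if its Minkowski functional
`gauge W` is of class `C¹` on the complement of its zero set. -/
def IsClassC1 {n : ℕ} (W : Set (EuclideanSpace ℝ (Fin n))) : Prop :=
  ContDiffOn ℝ 1 (gauge W) (gauge W ⁻¹' {0})ᶜ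

/-- The outer normal `∇ μ_W (x) / |∇ μ_W (x)|`, for `x` in the boundary of `W`, where `μ_W` is the
Minkowski functional of `W`. -/
def outerNormal {n : ℕ} (W : Set (EuclideanSpace ℝ (Fin n))) (x : EuclideanSpace ℝ (Fin n)) :
    EuclideanSpace ℝ (Fin n) :=
  ‖∇ (gauge W) x‖⁻¹ • ∇ (gauge W) x

/-- The cone `{x : ε ⟨w, x - p⟩ ≥ |P_Y (x - p)|}`, with `P_Y` the orthogonal projection
onto `Y`. -/
def projCone {n : ℕ} (Y : Submodule ℝ (EuclideanSpace ℝ (Fin n))) (ε : ℝ)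
    (w p : EuclideanSpace ℝ (Fin n)) : Set (EuclideanSpace ℝ (Fin n)) :=
  {x | ‖Y.orthogonalProjectionOnto (x - p)‖ ≤ ε * ⟪w, x - p⟫_ℝ}

/-- The span of the image of a unit vector field `N` on `E`. -/
def normalSpan {n : ℕ} {E : Set (EuclideanSpace ℝ (Fin n))}
    (N : E → Metric.sphere (0 : EuclideanSpace ℝ (Fin n)) 1) :
    Submodule ℝ (EuclideanSpace ℝ (Fin n)) :=
  Submodule.span ℝ (range fun y : E => (N y : EuclideanSpace ℝ (Fin n)))

end

/-! Everything is phrased with functionals `ξ` satisfying `⟪ξ, ·⟫ ≤ 1` on the body, i.e. with its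
polar. For a `C¹` body, the gradient of the gauge at a boundary point `x` is the only polar element
with value 1 at `x`; conversely, unique contact at every boundary point makes the gauge `C¹` off its
zero set (`contDiffOn_gauge_of_unique_support`).

Necessity. The polar is compact, so gradients are bounded, which gives condition 3; condition 1 is
the support inequality. The gauge factors through the projection to `X`, so in condition 2 one
passes to limits of bounded points, and uniqueness identifies the limiting gradients. For condition
4, choose normals whose components orthogonal to `Y` are independent; narrow cones with distant
apexes leave their half-spaces.

Sufficiency. Normalise to `g y = N y / ⟪N y, y⟫`, bounded by condition 3, and work in `X`. The cones
supply finitely many extra functionals that complete the span but stay below 1/2 on `E`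
(`exists_finite_complement`). Condition 2 says that each point of the closure `A` of the projection
of `E` is touched by exactly one functional of the resulting compact set `K`
(`existsUnique_limit_functional`). In `exists_smooth_body`, let `m` be the support function of `K`.
A union `S` of balls inside `{m ≤ 1}`, with radii vanishing exactly on `A` and quadratically small
near it, has at most one normal direction at each point: the radial one on a genuine ball, the
gradient of `m` on `A`. Since `K` spans, `S` is pointed, so supporting hyperplanes of its closed
convex hull touch `S` (`exists_contact`); hence the hull is `C¹`. Its preimage under the projection
is the required body. -/

section SupportFunctions

/-! ### Supporting functionals and differentiability of the gauge. -/

variable {V : Type*} [NormedAddCommGroup V] [InnerProductSpace ℝ V]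

/-- Every cluster point of the maximizers `f y` as `y → x` is a maximizer at `x`, by continuity of
`σ`; compactness does the rest. -/
theorem continuousAt_of_unique_maximizer {K : Set V} (hK : IsCompact K) {σ : V → ℝ}
    (hσ : Continuous σ) {f : V → V} (hfK : ∀ y, f y ∈ K) (hf : ∀ y, ⟪f y, y⟫_ℝ = σ y) {x : V}
    (hu : ∀ ξ ∈ K, ⟪ξ, x⟫_ℝ = σ x → ξ = f x) : ContinuousAt f x := by
  refine hK.tendsto_nhds_of_unique_mapClusterPt (Eventually.of_forall hfK) fun ξ hξ hcl => ?_
  obtain ⟨U, hU, hUf⟩ := mapClusterPt_iff_ultrafilter.1 hcl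
  refine hu ξ hξ (tendsto_nhds_unique (f := fun y => ⟪f y, y⟫_ℝ) (l := (U : Filter V)) ?_ ?_)
  · exact hUf.inner (tendsto_id.mono_left hU)
  · simp only [hf]
    exact (hσ.tendsto x).mono_left hU

/-- The first-order error lies between `0` and `⟪f y - f x, y - x⟫`, which is small by continuity of
`f` at `x`. -/
theorem hasGradientAt_of_unique_maximizer [CompleteSpace V] {K : Set V} (hK : IsCompact K)
    {σ : V → ℝ} (hσ : Continuous σ) (hle : ∀ ξ ∈ K, ∀ y, ⟪ξ, y⟫_ℝ ≤ σ y) {f : V → V}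
    (hfK : ∀ y, f y ∈ K) (hf : ∀ y, ⟪f y, y⟫_ℝ = σ y) {x : V}
    (hu : ∀ ξ ∈ K, ⟪ξ, x⟫_ℝ = σ x → ξ = f x) : HasGradientAt σ (f x) x := by
  have hc := continuousAt_of_unique_maximizer hK hσ hfK hf hu
  rw [hasGradientAt_iff_isLittleO, Asymptotics.isLittleO_iff]
  intro c hcpos
  filter_upwards [Metric.tendsto_nhds.1 hc c hcpos] with y hy
  have h1 : 0 ≤ σ y - σ x - ⟪f x, y - x⟫_ℝ := by
    have := hle _ (hfK x) y
    rw [inner_sub_right, hf x]; linarith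
  have h2 : σ y - σ x - ⟪f x, y - x⟫_ℝ ≤ ⟪f y - f x, y - x⟫_ℝ := by
    have := hle _ (hfK y) x
    rw [inner_sub_left, inner_sub_right (f y), hf y]; linarith
  rw [Real.norm_of_nonneg h1]
  refine h2.trans ((real_inner_le_norm _ _).trans ?_)
  rw [dist_eq_norm] at hy
  gcongr

theorem HasGradientAt.hasDerivAt_line [CompleteSpace V] {σ : V → ℝ} {ξ x : V}
    (h : HasGradientAt σ ξ x) (u : V) :
    HasDerivAt (fun t : ℝ => σ (x + t • u)) ⟪ξ, u⟫_ℝ 0 := by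
  have h1 : HasDerivAt (fun t : ℝ => x + t • u) u 0 := by
    simpa using ((hasDerivAt_id (0 : ℝ)).smul_const u).const_add x
  have h2 : HasFDerivAt σ (InnerProductSpace.toDual ℝ V ξ) (x + (0 : ℝ) • u) := by
    simpa using h.hasFDerivAt
  simpa [Function.comp_def] using h2.comp_hasDerivAt (0 : ℝ) h1

theorem continuous_gauge_of_zero_mem_interior {W : Set V} (hW : Convex ℝ W)
    (h0 : 0 ∈ interior W) : Continuous (gauge W) :=
  continuous_gauge hW (mem_interior_iff_mem_nhds.1 h0)

theorem HasGradientAt.inner_le_gauge [CompleteSpace V] {W : Set V} (hW : Convex ℝ W)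
    (h0 : 0 ∈ interior W) {ξ x : V} (h : HasGradientAt (gauge W) ξ x) (y : V) :
    ⟪ξ, y⟫_ℝ ≤ gauge W y := by
  have hab : Absorbent ℝ W := absorbent_nhds_zero (mem_interior_iff_mem_nhds.1 h0)
  have hd := h.hasDerivAt_line y
  have ht := hd.hasDerivWithinAt (s := Ioi 0)
  rw [hasDerivWithinAt_iff_tendsto_slope' (by simp)] at ht
  refine le_of_tendsto ht ?_
  filter_upwards [self_mem_nhdsWithin] with t ht
  have ht : (0 : ℝ) < t := ht
  have h1 : gauge W (x + t • y) ≤ gauge W x + t * gauge W y := by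
    refine (gauge_add_le hW hab _ _).trans ?_
    rw [gauge_smul_of_nonneg ht.le, smul_eq_mul]
  rw [slope_def_field, div_le_iff₀ (by linarith)]
  simp only [zero_smul, add_zero, sub_zero]
  nlinarith

/-- Euler's identity for a function homogeneous of degree one. -/
theorem HasGradientAt.inner_self_eq_gauge [CompleteSpace V] {W : Set V}
    {ξ x : V} (h : HasGradientAt (gauge W) ξ x) : ⟪ξ, x⟫_ℝ = gauge W x := by
  have hd := h.hasDerivAt_line x
  refine hd.unique ?_
  have h1 : HasDerivAt (fun t : ℝ => (1 + t) * gauge W x) (gauge W x) 0 := by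
    simpa using ((hasDerivAt_id (0 : ℝ)).const_add 1).mul_const (gauge W x)
  refine h1.congr_of_eventuallyEq ?_
  filter_upwards [Ioi_mem_nhds (show (-1 : ℝ) < 0 by norm_num)] with t ht
  have ht : -1 < t := ht
  rw [show x + t • x = (1 + t) • x by module, gauge_smul_of_nonneg (by linarith), smul_eq_mul]

/-- The difference `σ - ⟪ξ', ·⟫` has a minimum at `x`, so its directional derivatives vanish there.
-/
theorem HasGradientAt.eq_of_support [CompleteSpace V] {σ : V → ℝ} {ξ ξ' x : V}
    (h : HasGradientAt σ ξ x) (hle : ∀ y, ⟪ξ', y⟫_ℝ ≤ σ y) (hx : ⟪ξ', x⟫_ℝ = σ x) : ξ' = ξ := by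
  have key : ∀ u, ⟪ξ, u⟫_ℝ - ⟪ξ', u⟫_ℝ = 0 := by
    intro u
    have h1 : HasDerivAt (fun t : ℝ => ⟪ξ', x⟫_ℝ + t * ⟪ξ', u⟫_ℝ) ⟪ξ', u⟫_ℝ 0 := by
      simpa using ((hasDerivAt_id (0 : ℝ)).mul_const ⟪ξ', u⟫_ℝ).const_add ⟪ξ', x⟫_ℝ
    refine IsLocalMin.hasDerivAt_eq_zero (Eventually.of_forall fun t => ?_)
      ((h.hasDerivAt_line u).sub h1)
    have := hle (x + t • u)
    rw [inner_add_right, inner_smul_right] at this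
    simp only [Pi.sub_apply, zero_smul, add_zero, zero_mul, hx, sub_self]
    linarith
  refine ext_inner_right ℝ fun u => ?_
  linarith [key u]

theorem inner_le_gauge_of_le_one {W : Set V} (h0 : 0 ∈ interior W) {ξ : V}
    (h : ∀ s ∈ W, ⟪ξ, s⟫_ℝ ≤ 1) (y : V) : ⟪ξ, y⟫_ℝ ≤ gauge W y := by
  have hab : Absorbent ℝ W := absorbent_nhds_zero (mem_interior_iff_mem_nhds.1 h0)
  refine le_of_forall_pos_lt_add fun ε hε => ?_
  obtain ⟨b, hb0, hb, s, hs, rfl⟩ :=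
    exists_lt_of_gauge_lt hab (show gauge W y < gauge W y + ε by linarith)
  simp only [inner_smul_right]
  nlinarith [h s hs]

theorem exists_support_eq_gauge [CompleteSpace V] {W : Set V} (hW : Convex ℝ W)
    (h0 : 0 ∈ interior W) (y : V) :
    ∃ ξ : V, (∀ s ∈ W, ⟪ξ, s⟫_ℝ ≤ 1) ∧ ⟪ξ, y⟫_ℝ = gauge W y := by
  have hn := mem_interior_iff_mem_nhds.1 h0
  rcases (gauge_nonneg (s := W) y).eq_or_lt with hy | hy
  · exact ⟨0, by simp, by simpa using hy⟩
  have h1 : gauge W ((gauge W y)⁻¹ • y) = 1 := by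
    rw [gauge_smul_of_nonneg (by positivity), smul_eq_mul, inv_mul_cancel₀ hy.ne']
  set w := (gauge W y)⁻¹ • y with hw
  have hwi : w ∉ interior W := by
    rw [← gauge_lt_one_iff_mem_interior hW hn, h1]; exact lt_irrefl 1
  obtain ⟨f, hf⟩ := geometric_hahn_banach_open_point hW.interior isOpen_interior hwi
  have hfw : 0 < f w := by simpa using hf 0 h0
  obtain ⟨v, hv⟩ : ∃ v : V, ∀ z, f z = ⟪v, z⟫_ℝ :=
    ⟨(InnerProductSpace.toDual ℝ V).symm f, fun z => by simp⟩
  have hcl : ∀ s ∈ W, ⟪v, s⟫_ℝ ≤ ⟪v, w⟫_ℝ := by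
    intro s hs
    have hs' : s ∈ closure (interior W) := by
      rw [hW.closure_interior_eq_closure_of_nonempty_interior ⟨0, h0⟩]
      exact subset_closure hs
    refine closure_minimal (t := {s | ⟪v, s⟫_ℝ ≤ ⟪v, w⟫_ℝ}) ?_ ?_ hs'
    · intro a ha
      have := hf a ha
      rw [hv, hv] at this
      exact this.le
    · exact isClosed_le (by fun_prop) (by fun_prop)
  rw [hv] at hfw
  refine ⟨(⟪v, w⟫_ℝ)⁻¹ • v, fun s hs => ?_, ?_⟩
  · rw [real_inner_smul_left, inv_mul_le_iff₀ hfw, mul_one]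
    exact hcl s hs
  · have : ⟪v, y⟫_ℝ = gauge W y * ⟪v, w⟫_ℝ := by
      rw [hw, inner_smul_right, mul_inv_cancel_left₀ hy.ne']
    rw [real_inner_smul_left, this]
    field_simp

theorem isCompact_polar [FiniteDimensional ℝ V] {W : Set V} (h0 : 0 ∈ interior W) :
    IsCompact {ξ : V | ∀ s ∈ W, ⟪ξ, s⟫_ℝ ≤ 1} := by
  have : ProperSpace V := FiniteDimensional.proper ℝ V
  obtain ⟨r, hr, hrW⟩ := Metric.nhds_basis_closedBall.mem_iff.1 (mem_interior_iff_mem_nhds.1 h0)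
  refine (isCompact_closedBall (0 : V) r⁻¹).of_isClosed_subset ?_ ?_
  · simp only [Set.ofPred_forall]
    exact isClosed_biInter fun s _ => isClosed_le (by fun_prop) (by fun_prop)
  · intro ξ hξ
    rw [mem_closedBall_zero_iff]
    by_cases hz : ξ = 0
    · subst hz; simp [hr.le]
    have hp : 0 < ‖ξ‖ := norm_pos_iff.2 hz
    have := hξ ((r / ‖ξ‖) • ξ) (hrW (by
      rw [mem_closedBall_zero_iff, norm_smul, norm_div, norm_norm, div_mul_cancel₀ _ hp.ne',
        Real.norm_of_nonneg hr.le]))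
    rw [inner_smul_right, real_inner_self_eq_norm_sq] at this
    rw [← one_div, le_div_iff₀ hr]
    calc ‖ξ‖ * r = r / ‖ξ‖ * ‖ξ‖ ^ 2 := by field_simp
      _ ≤ 1 := this

/-- If every boundary point of `W` has a unique supporting functional, then the Minkowski
functional of `W` is differentiable, with continuous gradient, off its zero set. -/
theorem contDiffOn_gauge_of_unique_support [FiniteDimensional ℝ V] [CompleteSpace V] {W : Set V}
    (hW : Convex ℝ W) (h0 : 0 ∈ interior W)
    (hu : ∀ w, gauge W w = 1 → ∀ ξ ξ' : V, (∀ s ∈ W, ⟪ξ, s⟫_ℝ ≤ 1) → (∀ s ∈ W, ⟪ξ', s⟫_ℝ ≤ 1) →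
      ⟪ξ, w⟫_ℝ = 1 → ⟪ξ', w⟫_ℝ = 1 → ξ = ξ') :
    ContDiffOn ℝ 1 (gauge W) (gauge W ⁻¹' {0})ᶜ ∧
    ∀ ξ w : V, (∀ s ∈ W, ⟪ξ, s⟫_ℝ ≤ 1) → gauge W w ≠ 0 → ⟪ξ, w⟫_ℝ = gauge W w →
      HasGradientAt (gauge W) ξ w := by
  choose f hfK hf using exists_support_eq_gauge hW h0
  have hK := isCompact_polar h0
  have hσ := continuous_gauge_of_zero_mem_interior hW h0
  have hle : ∀ ξ ∈ {ξ : V | ∀ s ∈ W, ⟪ξ, s⟫_ℝ ≤ 1}, ∀ y, ⟪ξ, y⟫_ℝ ≤ gauge W y :=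
    fun ξ hξ y => inner_le_gauge_of_le_one h0 hξ y
  have hu' : ∀ x, gauge W x ≠ 0 → ∀ ξ ∈ {ξ : V | ∀ s ∈ W, ⟪ξ, s⟫_ℝ ≤ 1},
      ⟪ξ, x⟫_ℝ = gauge W x → ξ = f x := by
    intro x hx ξ hξ hξx
    -- Uniqueness is assumed only where the gauge is 1; homogeneity carries it to every point of
    -- nonzero gauge.
    refine hu ((gauge W x)⁻¹ • x) ?_ ξ (f x) hξ (hfK x) ?_ ?_
    · rw [gauge_smul_of_nonneg (inv_nonneg.2 (gauge_nonneg x)), smul_eq_mul, inv_mul_cancel₀ hx]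
    · rw [inner_smul_right, hξx, inv_mul_cancel₀ hx]
    · rw [inner_smul_right, hf, inv_mul_cancel₀ hx]
  have hgrad : ∀ x, gauge W x ≠ 0 → HasGradientAt (gauge W) (f x) x := fun x hx =>
    hasGradientAt_of_unique_maximizer hK hσ hle hfK hf (hu' x hx)
  refine ⟨?_, fun ξ w hξ hw hξw => ?_⟩
  · have ho : IsOpen (gauge W ⁻¹' {0})ᶜ := (isClosed_singleton.preimage hσ).isOpen_compl
    rw [show (1 : WithTop ℕ∞) = 0 + 1 by simp, contDiffOn_succ_iff_fderiv_of_isOpen ho]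
    refine ⟨fun x hx => (hgrad x hx).differentiableAt.differentiableWithinAt, by simp, ?_⟩
    rw [contDiffOn_zero]
    intro x hx
    refine ContinuousAt.continuousWithinAt ?_
    have h1 : ContinuousAt (fun y => InnerProductSpace.toDual ℝ V (f y)) x :=
      (InnerProductSpace.toDual ℝ V).continuous.continuousAt.comp
        (continuousAt_of_unique_maximizer hK hσ hfK hf (hu' x hx))
    refine h1.congr ?_
    filter_upwards [ho.mem_nhds hx] with y hy
    exact (hgrad y hy).hasFDerivAt.fderiv.symm
  · rw [hu' w hw ξ hξ hξw]
    exact hgrad w hw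

end SupportFunctions

/-! ### Smooth bodies with prescribed contact functionals. -/

section Construction

variable {V : Type*} [NormedAddCommGroup V] [InnerProductSpace ℝ V]

/-- A set bounded by the functionals in `G` grows linearly, along `span G`, with respect to a
suitable linear functional. -/
theorem exists_norm_orthogonalProjectionOnto_le [FiniteDimensional ℝ V] (G : Set V) :
    ∃ a ∈ Submodule.span ℝ G, ∃ C : ℝ, ∀ s, (∀ g ∈ G, ⟪g, s⟫_ℝ ≤ 1) →
      ‖(Submodule.span ℝ G).orthogonalProjectionOnto s‖ ≤ ⟪a, s⟫_ℝ + C := by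
  have key : ∀ v ∈ Submodule.span ℝ G, ∃ a ∈ Submodule.span ℝ G, ∃ C : ℝ, ∀ s,
      (∀ g ∈ G, ⟪g, s⟫_ℝ ≤ 1) → |⟪v, s⟫_ℝ| ≤ ⟪a, s⟫_ℝ + C := by
    intro v hv
    induction hv using Submodule.span_induction with
    | mem g hg =>
      -- If `t ≤ 1` then `|t| ≤ 2 - t`: a one-sided bound controls the absolute value up to a linear
      -- term.
      refine ⟨-g, neg_mem (Submodule.subset_span hg), 2, fun s hs => ?_⟩
      have := hs g hg
      rw [inner_neg_left, abs_le]
      constructor <;> linarith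
    | zero => exact ⟨0, zero_mem _, 0, by simp⟩
    | add x y _ _ hx hy =>
      obtain ⟨a, ha, C, h⟩ := hx
      obtain ⟨b, hb, D, h'⟩ := hy
      refine ⟨a + b, add_mem ha hb, C + D, fun s hs => ?_⟩
      rw [inner_add_left, inner_add_left]
      linarith [abs_add_le ⟪x, s⟫_ℝ ⟪y, s⟫_ℝ, h s hs, h' s hs]
    | smul c x _ hx =>
      obtain ⟨a, ha, C, h⟩ := hx
      refine ⟨|c| • a, Submodule.smul_mem _ _ ha, |c| * C, fun s hs => ?_⟩
      rw [real_inner_smul_left, real_inner_smul_left, abs_mul, ← mul_add]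
      exact mul_le_mul_of_nonneg_left (h s hs) (abs_nonneg c)
  set Y := Submodule.span ℝ G
  let b := stdOrthonormalBasis ℝ Y
  choose a ha C h using fun i => key (b i) (b i).2
  refine ⟨∑ i, a i, sum_mem fun i _ => ha i, ∑ i, C i, fun s hs => ?_⟩
  rw [sum_inner, ← Finset.sum_add_distrib]
  calc ‖Y.orthogonalProjectionOnto s‖
      = ‖∑ i, ⟪b i, Y.orthogonalProjectionOnto s⟫_ℝ • b i‖ := by rw [b.sum_repr']
    _ ≤ ∑ i, ‖⟪b i, Y.orthogonalProjectionOnto s⟫_ℝ • b i‖ := norm_sum_le _ _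
    _ ≤ ∑ i, (⟪a i, s⟫_ℝ + C i) := Finset.sum_le_sum fun i _ => by
      rw [norm_smul, b.norm_eq_one, mul_one,
        Submodule.inner_orthogonalProjectionOnto_eq_of_mem_left]
      exact h i s hs

/-- A supporting hyperplane of the closed convex hull of a pointed closed set touches the set. -/
theorem exists_contact [FiniteDimensional ℝ V] {S : Set V} (hS : IsClosed S) {a : V} {C : ℝ}
    (ha : ∀ s ∈ S, ‖s‖ ≤ ⟪a, s⟫_ℝ + C) {ζ : V} (hζ : ∀ s ∈ S, ⟪ζ, s⟫_ℝ ≤ 1) {w : V}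
    (hw : w ∈ closure (convexHull ℝ S)) (hζw : ⟪ζ, w⟫_ℝ = 1) : ∃ s ∈ S, ⟪ζ, s⟫_ℝ = 1 := by
  have : ProperSpace V := FiniteDimensional.proper ℝ V
  by_contra! hne
  set R := max 1 (⟪a, w⟫_ℝ + C + 1) with hR
  have hR0 : 0 < R := lt_of_lt_of_le one_pos (le_max_left _ _)
  have hRw : ⟪a, w⟫_ℝ + C < R := lt_of_lt_of_le (by linarith) (le_max_right _ _)
  have hT : IsCompact (S ∩ Metric.closedBall 0 R) :=
    (isCompact_closedBall (0 : V) R).inter_left hS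
  obtain ⟨δ, hδ, hδT⟩ : ∃ δ : ℝ, 0 < δ ∧ ∀ s ∈ S, ‖s‖ ≤ R → δ ≤ 1 - ⟪ζ, s⟫_ℝ := by
    rcases (S ∩ Metric.closedBall 0 R).eq_empty_or_nonempty with he | hn
    · refine ⟨1, one_pos, fun s hs hsR => ?_⟩
      have : s ∈ S ∩ Metric.closedBall 0 R := ⟨hs, by simpa using hsR⟩
      simp [he] at this
    · obtain ⟨t, ht, hmin⟩ := hT.exists_isMinOn hn
        (f := fun s => 1 - ⟪ζ, s⟫_ℝ) (by fun_prop)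
      refine ⟨1 - ⟪ζ, t⟫_ℝ, sub_pos.2 (lt_of_le_of_ne (hζ t ht.1) (hne t ht.1)), ?_⟩
      intro s hs hsR
      exact hmin ⟨hs, by simpa using hsR⟩
  -- Without contact, `ζ` has a gap `δ` on the part of `S` in the ball of radius `R`. Tilting by `(δ
  -- / R) • a` spends that gap nearby, while beyond `R` the growth of `a` restores it. The tilted
  -- bound passes to the hull but fails at `w`, because `R` exceeds `⟪a, w⟫ + C`.
  have hsub : closure (convexHull ℝ S) ⊆
      {v | ⟪ζ - (δ / R) • a, v⟫_ℝ ≤ 1 - δ + δ / R * C} := by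
    refine closure_minimal (convexHull_min (fun s hs => ?_) ?_)
      (isClosed_le (by fun_prop) (by fun_prop))
    · rw [mem_ofPred_eq, inner_sub_left, real_inner_smul_left]
      have h1 := ha s hs
      rcases le_or_gt ‖s‖ R with hsR | hsR
      · have := hδT s hs hsR
        have : 0 ≤ δ / R * (⟪a, s⟫_ℝ + C) :=
          mul_nonneg (by positivity) ((norm_nonneg s).trans h1)
        linarith
      · have h2 : δ / R * R ≤ δ / R * (⟪a, s⟫_ℝ + C) :=
          mul_le_mul_of_nonneg_left (by linarith) (by positivity)
        rw [div_mul_cancel₀ _ hR0.ne'] at h2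
        linarith [hζ s hs]
    · exact convex_halfSpace_le (innerₛₗ ℝ (ζ - (δ / R) • a)).isLinear _
  have h1 := hsub hw
  rw [mem_ofPred_eq, inner_sub_left, real_inner_smul_left, hζw] at h1
  have h2 : δ / R * (⟪a, w⟫_ℝ + C) < δ / R * R := by gcongr
  rw [div_mul_cancel₀ _ hR0.ne'] at h2
  linarith

/-- Supplies the ball radii, as a truncated squared distance. The square makes them second order
near `A`, so they do not disturb the first-order behaviour there. -/
theorem exists_sq_dist_minorant {V : Type*} [NormedAddCommGroup V] (A : Set V) (hA : IsClosed A) {κ : ℝ} (hκ : 0 < κ) :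
    ∃ φ : V → ℝ, Continuous φ ∧ (∀ y, 0 ≤ φ y) ∧ (∀ y, φ y ≤ κ) ∧ (∀ y, φ y = 0 ↔ y ∈ A) ∧
      ∀ x ∈ A, ∀ y, φ y ≤ ‖y - x‖ ^ 2 := by
  rcases A.eq_empty_or_nonempty with rfl | hne
  -- `Metric.infDist` to the empty set is 0, so the general formula would vanish everywhere.
  · exact ⟨fun _ => κ, continuous_const, fun _ => hκ.le, fun _ => le_rfl,
      fun _ => by simp [hκ.ne'], by simp⟩
  · refine ⟨fun y => min κ (Metric.infDist y A ^ 2), by fun_prop, fun y => by positivity,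
      fun y => min_le_left _ _, fun y => ?_, fun x hx y => ?_⟩
    · rw [hA.mem_iff_infDist_zero hne]
      refine ⟨fun h => ?_, fun h => by simp [h, hκ.le]⟩
      change min κ (Metric.infDist y A ^ 2) = 0 at h
      rcases min_choice κ (Metric.infDist y A ^ 2) with h' | h' <;> rw [h'] at h
      · exact absurd h hκ.ne'
      · simpa using h
    · refine (min_le_right _ _).trans ?_
      have h := Metric.infDist_le_dist_of_mem hx (x := y)
      rw [dist_eq_norm] at h
      exact pow_le_pow_left₀ Metric.infDist_nonneg h 2

theorem exists_smul_eq_of_inner_nonpos {g ξ : V}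
    (h : ∀ u, ⟪g, u⟫_ℝ < 0 → ⟪ξ, u⟫_ℝ ≤ 0) (hg : g ≠ 0) : ∃ c : ℝ, ξ = c • g := by
  have hg2 : 0 < ⟪g, g⟫_ℝ := real_inner_self_pos.2 hg
  set c := ⟪ξ, g⟫_ℝ / ⟪g, g⟫_ℝ with hc
  have hcg : ⟪ξ, g⟫_ℝ = c * ⟪g, g⟫_ℝ := by rw [hc]; field_simp
  refine ⟨c, ?_⟩
  set v := ξ - c • g with hv
  have hgv : ⟪g, v⟫_ℝ = 0 := by
    rw [hv, inner_sub_right, inner_smul_right, real_inner_comm, hcg]; ring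
  have hξv : ⟪ξ, v⟫_ℝ = ⟪v, v⟫_ℝ := by
    conv_lhs => rw [show ξ = v + c • g by rw [hv]; abel]
    rw [inner_add_left, real_inner_smul_left, hgv]; ring
  have h1 : ∀ δ : ℝ, 0 < δ → ⟪v, v⟫_ℝ ≤ δ * ⟪ξ, g⟫_ℝ := by
    intro δ hδ
    have := h (v - δ • g) (by rw [inner_sub_right, inner_smul_right, hgv]; nlinarith)
    rw [inner_sub_right, inner_smul_right, hξv] at this
    linarith
  have h2 : ⟪v, v⟫_ℝ ≤ 0 := by
    have ht : Tendsto (fun δ : ℝ => δ * ⟪ξ, g⟫_ℝ) (𝓝[>] 0) (𝓝 (0 * ⟪ξ, g⟫_ℝ)) :=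
      (tendsto_id.mul_const _).mono_left nhdsWithin_le_nhds
    rw [zero_mul] at ht
    exact ge_of_tendsto ht (by filter_upwards [self_mem_nhdsWithin] with δ hδ using h1 δ hδ)
  exact sub_eq_zero.1 (real_inner_self_nonpos.1 h2)

/-- Equality case of Cauchy–Schwarz: testing the point of the ball furthest along `ξ` gives `r * ‖ξ‖
≤ ⟪ξ, s - y⟫`. -/
theorem smul_eq_smul_of_closedBall_support {ξ s y : V} {r : ℝ} (hr : 0 ≤ r)
    (hs : ‖s - y‖ ≤ r) (h : ∀ t, ‖t - y‖ ≤ r → ⟪ξ, t⟫_ℝ ≤ ⟪ξ, s⟫_ℝ) :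
    r • ξ = ‖ξ‖ • (s - y) := by
  rcases eq_or_ne ξ 0 with rfl | hξ
  · simp
  have hp : 0 < ‖ξ‖ := norm_pos_iff.2 hξ
  have h1 := h (y + (r / ‖ξ‖) • ξ) (by
    rw [add_sub_cancel_left, norm_smul, norm_div, norm_norm, div_mul_cancel₀ _ hp.ne',
      Real.norm_of_nonneg hr])
  rw [inner_add_right, inner_smul_right, real_inner_self_eq_norm_sq] at h1
  have h2 : r * ‖ξ‖ ≤ ⟪ξ, s - y⟫_ℝ := by
    rw [inner_sub_right]
    have : r / ‖ξ‖ * ‖ξ‖ ^ 2 = r * ‖ξ‖ := by field_simp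
    linarith
  have h3 : ‖r • ξ - ‖ξ‖ • (s - y)‖ ^ 2 ≤ 0 := by
    rw [norm_sub_sq_real, norm_smul, norm_smul, real_inner_smul_left, inner_smul_right, norm_norm,
      Real.norm_of_nonneg hr]
    have h4 : ‖s - y‖ ^ 2 ≤ r ^ 2 := pow_le_pow_left₀ (norm_nonneg _) hs 2
    nlinarith [mul_le_mul_of_nonneg_left h4 (sq_nonneg ‖ξ‖),
      mul_le_mul_of_nonneg_left h2 (mul_nonneg hr hp.le)]
  have h5 : ‖r • ξ - ‖ξ‖ • (s - y)‖ = 0 := by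
    have := sq_nonneg ‖r • ξ - ‖ξ‖ • (s - y)‖
    exact pow_eq_zero_iff two_ne_zero |>.1 (le_antisymm h3 this)
  exact sub_eq_zero.1 (norm_eq_zero.1 h5)

/-- A compact set of functionals has a maximal value function, which is Lipschitz. -/
theorem exists_sup_inner {K : Set V} (hK : IsCompact K) (hne : K.Nonempty) :
    ∃ (m : V → ℝ) (f : V → V) (L : ℝ), 0 ≤ L ∧ Continuous m ∧ (∀ y z, m y - m z ≤ L * ‖y - z‖) ∧
      (∀ y, f y ∈ K) ∧ (∀ y, ⟪f y, y⟫_ℝ = m y) ∧ ∀ ξ ∈ K, ∀ y, ⟪ξ, y⟫_ℝ ≤ m y := by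
  choose f hfK hf using fun y : V => hK.exists_isMaxOn hne (f := fun ξ => ⟪ξ, y⟫_ℝ) (by fun_prop)
  obtain ⟨L, hL, hLK⟩ : ∃ L : ℝ, 0 ≤ L ∧ ∀ ξ ∈ K, ‖ξ‖ ≤ L := by
    obtain ⟨L, hL⟩ := hK.isBounded.exists_norm_le
    exact ⟨max L 0, le_max_right _ _, fun ξ hξ => (hL ξ hξ).trans (le_max_left _ _)⟩
  have hlip : ∀ y z, ⟪f y, y⟫_ℝ - ⟪f z, z⟫_ℝ ≤ L * ‖y - z‖ := by
    intro y z
    have h1 : ⟪f y, z⟫_ℝ ≤ ⟪f z, z⟫_ℝ := hf z (hfK y)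
    have h2 : ⟪f y, y - z⟫_ℝ ≤ L * ‖y - z‖ := (real_inner_le_norm _ _).trans
      (mul_le_mul_of_nonneg_right (hLK _ (hfK y)) (norm_nonneg _))
    rw [inner_sub_right] at h2
    linarith
  refine ⟨fun y => ⟪f y, y⟫_ℝ, f, L, hL, ?_, hlip, hfK, fun _ => rfl, fun ξ hξ y => hf y hξ⟩
  refine (LipschitzWith.of_le_add_mul ⟨L, hL⟩ fun y z => ?_).continuous
  rw [dist_eq_norm]
  have := hlip y z
  change _ ≤ _ + L * _
  linarith

/-- Given functionals `K` bounded by `1` on `A`, such that each point of `A` lies on exactly one of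
the hyperplanes `{g = 1}`, `g ∈ K`, there is a convex body of class `C¹`, contained in all of the
half-spaces `{g ≤ 1}`, whose boundary passes through the points of `A` with the given normals. -/
theorem exists_smooth_body [FiniteDimensional ℝ V] [CompleteSpace V] {K A : Set V}
    (hK : IsCompact K) (h0K : 0 ∈ K) (hspan : Submodule.span ℝ K = ⊤) (hA : IsClosed A)
    (hle : ∀ x ∈ A, ∀ g ∈ K, ⟪g, x⟫_ℝ ≤ 1)
    (huniq : ∀ x ∈ A, ∃ g ∈ K, ⟪g, x⟫_ℝ = 1 ∧ ∀ g' ∈ K, ⟪g', x⟫_ℝ = 1 → g' = g) :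
    ∃ W : Set V, IsClosed W ∧ Convex ℝ W ∧ 0 ∈ interior W ∧
      ContDiffOn ℝ 1 (gauge W) (gauge W ⁻¹' {0})ᶜ ∧ A ⊆ W ∧
      (∀ s ∈ W, ∀ g ∈ K, ⟪g, s⟫_ℝ ≤ 1) ∧
      ∀ x ∈ A, ∀ g ∈ K, ⟪g, x⟫_ℝ = 1 → gauge W x = 1 ∧ HasGradientAt (gauge W) g x := by
  have : ProperSpace V := FiniteDimensional.proper ℝ V
  obtain ⟨m, f, L, hL, hmc, hlip, hfK, hf, hKm⟩ := exists_sup_inner hK ⟨0, h0K⟩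
  -- The cap `(L + 1)⁻¹` gives `L * φ 0 ≤ 1`, so the ball centred at 0 is admitted to `S`; it also
  -- keeps centres bounded when proving `S` closed.
  obtain ⟨φ, hφc, hφ0, hφκ, hφA, hφd⟩ :=
    exists_sq_dist_minorant A hA (κ := (L + 1)⁻¹) (by positivity)
  have hLκ : L * (L + 1)⁻¹ ≤ 1 := by
    rw [← div_eq_mul_inv, div_le_one (by linarith)]; linarith
  have hmA : ∀ x ∈ A, m x = 1 := by
    intro x hx
    obtain ⟨g, hg, hgx, -⟩ := huniq x hx
    refine le_antisymm ?_ (hgx ▸ hKm g hg x)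
    rw [← hf x]; exact hle x hx _ (hfK x)
  have hm0 : m 0 = 0 := by rw [← hf 0, inner_zero_right]
  -- The margin `L * φ y` is the most `m` can grow over the ball of radius `φ y`, so all of `S` lies
  -- in `{m ≤ 1}`.
  set S : Set V := {s | ∃ y, m y + L * φ y ≤ 1 ∧ ‖s - y‖ ≤ φ y} with hSdef
  have hAS : A ⊆ S := fun x hx => ⟨x, by rw [hmA x hx, (hφA x).2 hx]; simp, by simp [hφ0]⟩
  have hSm : ∀ s ∈ S, m s ≤ 1 := by
    rintro s ⟨y, hy, hsy⟩
    have := hlip s y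
    nlinarith [mul_le_mul_of_nonneg_left hsy hL]
  have hSclosed : IsClosed S := by
    refine IsSeqClosed.isClosed fun s x hs hsx => ?_
    choose y hy hsy using hs
    obtain ⟨B, hB⟩ := (Metric.isBounded_range_of_tendsto s hsx).exists_norm_le
    have hyb : ∀ k, y k ∈ Metric.closedBall (0 : V) (B + (L + 1)⁻¹) := by
      intro k
      rw [mem_closedBall_zero_iff]
      have h1 := norm_sub_norm_le (y k) (s k)
      rw [norm_sub_rev] at h1
      linarith [hB _ (mem_range_self k), hsy k, hφκ (y k)]
    obtain ⟨z, -, ψ, hψ, hz⟩ := (isCompact_closedBall _ _).tendsto_subseq hyb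
    have hsψ := hsx.comp hψ.tendsto_atTop
    refine ⟨z, ?_, ?_⟩
    · exact le_of_tendsto (((hmc.add (hφc.const_mul L)).tendsto z).comp hz)
        (Eventually.of_forall fun k => hy (ψ k))
    · exact le_of_tendsto_of_tendsto (hsψ.sub hz).norm ((hφc.tendsto z).comp hz)
        (Eventually.of_forall fun k => hsy (ψ k))
  set W := closure (convexHull ℝ S) with hWdef
  have hSW : S ⊆ W := (subset_convexHull ℝ S).trans subset_closure
  have hWconv : Convex ℝ W := (convex_convexHull ℝ S).closure
  have hWK : ∀ s ∈ W, ∀ g ∈ K, ⟪g, s⟫_ℝ ≤ 1 := by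
    intro s hs g hg
    refine closure_minimal (t := {v | ⟪g, v⟫_ℝ ≤ 1}) (convexHull_min ?_ ?_) ?_ hs
    · exact fun v hv => (hKm g hg v).trans (hSm v hv)
    · exact convex_halfSpace_le (innerₛₗ ℝ g).isLinear _
    · exact isClosed_le (by fun_prop) (by fun_prop)
  have h0A : (0 : V) ∉ A := fun h => by have := hmA 0 h; rw [hm0] at this; norm_num at this
  have hφ00 : 0 < φ 0 := lt_of_le_of_ne (hφ0 0) fun h => h0A ((hφA 0).1 h.symm)
  have h0W : (0 : V) ∈ interior W := by
    rw [mem_interior_iff_mem_nhds]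
    refine mem_of_superset (Metric.closedBall_mem_nhds 0 hφ00) fun s hs => hSW ⟨0, ?_, ?_⟩
    · rw [hm0, zero_add]
      exact (mul_le_mul_of_nonneg_left (hφκ 0) hL).trans hLκ
    · simpa using hs
  obtain ⟨a, -, C, haC⟩ := exists_norm_orthogonalProjectionOnto_le K
  have hSpt : ∀ s ∈ S, ‖s‖ ≤ ⟪a, s⟫_ℝ + C := by
    intro s hs
    have := haC s fun g hg => hWK s (hSW hs) g hg
    have hmem : s ∈ Submodule.span ℝ K := hspan ▸ Submodule.mem_top
    rwa [Submodule.norm_orthogonalProjectionOnto_apply _ hmem] at this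
  have hdir : ∀ s ∈ S, ∃ ν : V, ∀ ξ : V, (∀ t ∈ S, ⟪ξ, t⟫_ℝ ≤ 1) → ⟪ξ, s⟫_ℝ = 1 →
      ∃ c : ℝ, ξ = c • ν := by
    rintro s ⟨y, hy, hsy⟩
    rcases (hφ0 y).eq_or_lt with h | h
    · have hyA : y ∈ A := (hφA y).1 h.symm
      have hsy' : s = y := by
        rw [← h] at hsy
        exact sub_eq_zero.1 (norm_eq_zero.1 (le_antisymm hsy (norm_nonneg _)))
      subst hsy'
      obtain ⟨g, hg, hgx, hgu⟩ := huniq s hyA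
      have hfs : f s = g := hgu _ (hfK s) (by rw [hf, hmA s hyA])
      have hgrad : HasGradientAt m g s := by
        rw [← hfs]
        refine hasGradientAt_of_unique_maximizer hK hmc hKm hfK hf fun ξ hξ hξs => ?_
        rw [hfs]; exact hgu ξ hξ (by rw [hξs, hmA s hyA])
      refine ⟨g, fun ξ hξ hξs => exists_smul_eq_of_inner_nonpos (fun u hu => ?_) ?_⟩
      -- Since `φ (s + t • u) ≤ t² ‖u‖²`, this function dominates the quantity defining `S`. Its
      -- derivative `⟪g, u⟫` is negative, so `s + t • u` lies in `S` for small `t > 0`.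
      · have hd : HasDerivAt (fun t : ℝ => m (s + t • u) + L * (t ^ 2 * ‖u‖ ^ 2)) ⟪g, u⟫_ℝ 0 := by
          have h2 : HasDerivAt (fun t : ℝ => L * (t ^ 2 * ‖u‖ ^ 2)) 0 0 := by
            simpa using (((hasDerivAt_id (0 : ℝ)).pow 2).mul_const (‖u‖ ^ 2)).const_mul L
          simpa using (hgrad.hasDerivAt_line u).fun_add h2
        have ht := hd.hasDerivWithinAt (s := Ioi 0)
        rw [hasDerivWithinAt_iff_tendsto_slope' (by simp)] at ht
        have hev := (ht.eventually (gt_mem_nhds hu)).and self_mem_nhdsWithin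
        obtain ⟨t, ht1, ht0⟩ := hev.exists
        have ht0 : (0 : ℝ) < t := ht0
        rw [slope_def_field, sub_zero, div_lt_iff₀ ht0, zero_mul] at ht1
        simp only [zero_smul, add_zero, hmA s hyA] at ht1
        have hmem : s + t • u ∈ S := by
          refine ⟨s + t • u, ?_, by simp [hφ0]⟩
          have h3 := hφd s hyA (s + t • u)
          rw [add_sub_cancel_left, norm_smul, mul_pow, Real.norm_eq_abs, sq_abs] at h3
          nlinarith [mul_le_mul_of_nonneg_left h3 hL]
        have h4 := hξ _ hmem
        rw [inner_add_right, inner_smul_right, hξs] at h4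
        nlinarith
      · rintro rfl
        simp at hgx
    · refine ⟨s - y, fun ξ hξ hξs => ⟨‖ξ‖ / φ y, ?_⟩⟩
      have h1 := smul_eq_smul_of_closedBall_support (ξ := ξ) h.le hsy fun t ht => by
        rw [hξs]; exact hξ t ⟨y, hy, ht⟩
      rw [div_eq_inv_mul, mul_smul, ← h1, inv_smul_smul₀ h.ne']
  obtain ⟨hC1, hgr⟩ := contDiffOn_gauge_of_unique_support hWconv h0W (by
    intro w hw ξ ξ' hξ hξ' hξw hξ'w
    have hwW : w ∈ W := by
      have := (gauge_le_one_iff_mem_closure hWconv (mem_interior_iff_mem_nhds.1 h0W)).1 hw.le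
      rwa [hWdef, closure_closure] at this
    -- The midpoint of the two functionals also supports `W` at `w`, so it touches `S` at some `s`.
    -- Both must then equal 1 at `s`, where only one normal direction is available.
    have hζ : ∀ s, ⟪(2⁻¹ : ℝ) • (ξ + ξ'), s⟫_ℝ = (⟪ξ, s⟫_ℝ + ⟪ξ', s⟫_ℝ) / 2 := by
      intro s
      rw [real_inner_smul_left, inner_add_left]; ring
    obtain ⟨s, hs, hs1⟩ := exists_contact hSclosed hSpt (ζ := (2⁻¹ : ℝ) • (ξ + ξ'))
      (fun s hs => by rw [hζ]; linarith [hξ s (hSW hs), hξ' s (hSW hs)]) hwW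
      (by rw [hζ, hξw, hξ'w]; norm_num)
    rw [hζ] at hs1
    have e1 : ⟪ξ, s⟫_ℝ = 1 := by linarith [hξ s (hSW hs), hξ' s (hSW hs)]
    have e2 : ⟪ξ', s⟫_ℝ = 1 := by linarith
    obtain ⟨ν, hν⟩ := hdir s hs
    obtain ⟨c, rfl⟩ := hν ξ (fun t ht => hξ t (hSW ht)) e1
    obtain ⟨c', rfl⟩ := hν ξ' (fun t ht => hξ' t (hSW ht)) e2
    rw [real_inner_smul_left] at e1 e2
    have hνs : ⟪ν, s⟫_ℝ ≠ 0 := by rintro h; rw [h] at e1; simp at e1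
    rw [mul_right_cancel₀ hνs (e1.trans e2.symm)])
  refine ⟨W, isClosed_closure, hWconv, h0W, hC1, hAS.trans hSW, hWK, fun x hx g hg hgx => ?_⟩
  have hg1 : gauge W x = 1 := le_antisymm (gauge_le_one_of_mem (hSW (hAS hx)))
    (hgx ▸ inner_le_gauge_of_le_one h0W (fun s hs => hWK s hs g hg) x)
  exact ⟨hg1, hgr g x (fun s hs => hWK s hs g hg) (by rw [hg1]; exact one_ne_zero)
    (by rw [hg1, hgx])⟩

end Construction

/-! ### Necessity of the four conditions. -/

section Necessity

/-- The components of `T` orthogonal to `Y` span `Yᗮ ⊓ X`, of dimension `dim X - dim Y`; a basis can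
be extracted from them. -/
theorem exists_linearIndependent_orthogonal_components {V : Type*} [NormedAddCommGroup V]
    [InnerProductSpace ℝ V] [FiniteDimensional ℝ V] {T : Set V} {X Y : Submodule ℝ V}
    (hX : X = Submodule.span ℝ T) (hY : Y ≤ X) :
    ∃ ν : Fin (Module.finrank ℝ X - Module.finrank ℝ Y) → V, (∀ i, ν i ∈ T) ∧
      LinearIndependent ℝ fun i => Yᗮ.starProjection (ν i) := by
  have hspan : Submodule.span ℝ (Yᗮ.starProjection '' T) = Yᗮ ⊓ X := by
    have h1 : Submodule.span ℝ (Yᗮ.starProjection '' T) =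
        X.map (Yᗮ.starProjection : V →ₗ[ℝ] V) := by
      rw [hX, Submodule.map_span]; rfl
    rw [h1]
    apply le_antisymm
    · rintro _ ⟨x, hx, rfl⟩
      refine ⟨Submodule.starProjection_apply_mem _ _, ?_⟩
      have h2 : Yᗮ.starProjection x = x - Y.starProjection x :=
        eq_sub_of_add_eq' (Y.starProjection_add_starProjection_orthogonal x)
      change Yᗮ.starProjection x ∈ X
      rw [h2]
      exact X.sub_mem hx (hY (Submodule.starProjection_apply_mem _ _))
    · rintro z ⟨hz, hzX⟩
      exact ⟨z, hzX, Submodule.starProjection_eq_self_iff.2 hz⟩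
  have hrank : Module.finrank ℝ X - Module.finrank ℝ Y =
      Module.finrank ℝ (Submodule.span ℝ (Yᗮ.starProjection '' T)) := by
    have := Submodule.finrank_add_inf_finrank_orthogonal hY
    rw [hspan]; omega
  obtain ⟨f, hf, -, hli⟩ := Submodule.exists_fun_fin_finrank_span_eq ℝ (Yᗮ.starProjection '' T)
  choose ν hν hνf using hf
  rw [hrank]
  refine ⟨ν, hν, ?_⟩
  simpa only [hνf] using hli

variable {n : ℕ} {W : Set (EuclideanSpace ℝ (Fin n))}

theorem IsClassC1.hasGradientAt (hC : IsClassC1 W) (hW : Convex ℝ W) (h0 : 0 ∈ interior W)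
    {x : EuclideanSpace ℝ (Fin n)} (hx : gauge W x ≠ 0) :
    HasGradientAt (gauge W) (∇ (gauge W) x) x := by
  have ho : IsOpen (gauge W ⁻¹' {0})ᶜ :=
    (isClosed_singleton.preimage (continuous_gauge_of_zero_mem_interior hW h0)).isOpen_compl
  exact ((hC.contDiffAt (ho.mem_nhds hx)).differentiableAt one_ne_zero).hasGradientAt

theorem IsClassC1.continuousAt_gradient (hC : IsClassC1 W) (hW : Convex ℝ W)
    (h0 : 0 ∈ interior W) {x : EuclideanSpace ℝ (Fin n)} (hx : gauge W x ≠ 0) :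
    ContinuousAt (∇ (gauge W)) x := by
  have ho : IsOpen (gauge W ⁻¹' {0})ᶜ :=
    (isClosed_singleton.preimage (continuous_gauge_of_zero_mem_interior hW h0)).isOpen_compl
  have h1 : ContinuousAt (fderiv ℝ (gauge W)) x :=
    (hC.continuousOn_fderiv_of_isOpen ho le_rfl).continuousAt (ho.mem_nhds hx)
  exact (InnerProductSpace.toDual ℝ _).symm.continuous.continuousAt.comp h1

/-- Otherwise a multiple `q` of `v` lies on the boundary, and the gradient at `q` pairs to 1 with
`q`. -/
theorem gauge_eq_zero_of_mem_orthogonal (hC : IsClassC1 W) (hW : Convex ℝ W)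
    (h0 : 0 ∈ interior W) {v : EuclideanSpace ℝ (Fin n)}
    (hv : ∀ q ∈ frontier W, ⟪outerNormal W q, v⟫_ℝ = 0) : gauge W v = 0 := by
  by_contra hne
  have hpos : 0 < gauge W v := lt_of_le_of_ne (gauge_nonneg _) (Ne.symm hne)
  have h1 : gauge W ((gauge W v)⁻¹ • v) = 1 := by
    rw [gauge_smul_of_nonneg (by positivity), smul_eq_mul, inv_mul_cancel₀ hne]
  have hq := (gauge_eq_one_iff_mem_frontier hW (mem_interior_iff_mem_nhds.1 h0)).1 h1
  have hg := hC.hasGradientAt hW h0 (x := (gauge W v)⁻¹ • v) (by rw [h1]; exact one_ne_zero)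
  have h2 := hg.inner_self_eq_gauge
  rw [h1, inner_smul_right] at h2
  have h3 := hv _ hq
  rw [outerNormal, real_inner_smul_left] at h3
  rcases mul_eq_zero.1 h3 with h | h
  · rw [inv_eq_zero, norm_eq_zero] at h
    rw [h] at h2; simp at h2
  · rw [h] at h2; simp at h2

/-- The gradients of the Minkowski functional at boundary points. -/
theorem IsClassC1.gradient_frontier (hC : IsClassC1 W) (hW : Convex ℝ W) (h0 : 0 ∈ interior W)
    {x : EuclideanSpace ℝ (Fin n)} (hx : x ∈ frontier W) :
    gauge W x = 1 ∧ ⟪∇ (gauge W) x, x⟫_ℝ = 1 ∧ 0 < ‖∇ (gauge W) x‖ ∧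
      ∀ y, ⟪∇ (gauge W) x, y⟫_ℝ ≤ gauge W y := by
  have h1 := (gauge_eq_one_iff_mem_frontier hW (mem_interior_iff_mem_nhds.1 h0)).2 hx
  have hg := hC.hasGradientAt hW h0 (x := x) (by rw [h1]; exact one_ne_zero)
  have h2 := hg.inner_self_eq_gauge
  refine ⟨h1, h2.trans h1, norm_pos_iff.2 fun h => ?_, hg.inner_le_gauge hW h0⟩
  rw [h, h1] at h2
  simp at h2

theorem IsClassC1.exists_norm_gradient_le (hC : IsClassC1 W) (hW : Convex ℝ W)
    (h0 : 0 ∈ interior W) : ∃ B : ℝ, 0 < B ∧ ∀ x ∈ frontier W, ‖∇ (gauge W) x‖ ≤ B := by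
  obtain ⟨B, hB⟩ := (isCompact_polar h0).isBounded.exists_norm_le
  refine ⟨max B 1, by positivity, fun x hx => (hB _ fun s hs => ?_).trans (le_max_left _ _)⟩
  exact ((hC.gradient_frontier hW h0 hx).2.2.2 s).trans (gauge_le_one_of_mem hs)

theorem inner_outerNormal_sub (hC : IsClassC1 W) (hW : Convex ℝ W) (h0 : 0 ∈ interior W)
    {x : EuclideanSpace ℝ (Fin n)} (hx : x ∈ frontier W) (y : EuclideanSpace ℝ (Fin n)) :
    ⟪outerNormal W x, y - x⟫_ℝ = ‖∇ (gauge W) x‖⁻¹ * (⟪∇ (gauge W) x, y⟫_ℝ - 1) := by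
  rw [outerNormal, real_inner_smul_left, inner_sub_right, (hC.gradient_frontier hW h0 hx).2.1]

/-- The gauge vanishes on `Xᗮ`; subadditivity in both directions removes that component. -/
theorem gauge_starProjection_eq (hC : IsClassC1 W) (hW : Convex ℝ W) (h0 : 0 ∈ interior W)
    {X : Submodule ℝ (EuclideanSpace ℝ (Fin n))}
    (hX : X = Submodule.span ℝ (outerNormal W '' frontier W)) (x : EuclideanSpace ℝ (Fin n)) :
    gauge W (X.starProjection x) = gauge W x := by
  have hab : Absorbent ℝ W := absorbent_nhds_zero (mem_interior_iff_mem_nhds.1 h0)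
  have hz : ∀ v ∈ Xᗮ, gauge W v = 0 := fun v hv =>
    gauge_eq_zero_of_mem_orthogonal hC hW h0 fun q hq =>
      Submodule.inner_right_of_mem_orthogonal
        (by rw [hX]; exact Submodule.subset_span (mem_image_of_mem _ hq)) hv
  have hm : x - X.starProjection x ∈ Xᗮ := Submodule.sub_starProjection_mem_orthogonal x
  apply le_antisymm
  · have h1 := gauge_add_le hW hab x (-(x - X.starProjection x))
    rw [hz _ (neg_mem hm)] at h1
    simpa using h1
  · have h1 := gauge_add_le hW hab (X.starProjection x) (x - X.starProjection x)
    rw [hz _ hm] at h1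
    simpa using h1

/-- Sequential asymptotic coincidence of normals along sequences with bounded projections. -/
theorem tendsto_norm_outerNormal_sub (hC : IsClassC1 W) (hW : Convex ℝ W) (h0 : 0 ∈ interior W)
    {X : Submodule ℝ (EuclideanSpace ℝ (Fin n))}
    (hX : X = Submodule.span ℝ (outerNormal W '' frontier W))
    {x z : ℕ → EuclideanSpace ℝ (Fin n)} (hx : ∀ k, x k ∈ frontier W)
    (hz : ∀ k, z k ∈ frontier W)
    (hb : Bornology.IsBounded (range fun k => X.orthogonalProjectionOnto (x k)))
    (hlim : Tendsto (fun k => ⟪outerNormal W (z k), x k - z k⟫_ℝ) atTop (𝓝 0)) :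
    Tendsto (fun k => ‖outerNormal W (z k) - outerNormal W (x k)‖) atTop (𝓝 0) := by
  have hX' : ∀ q ∈ frontier W, ∇ (gauge W) q ∈ X := by
    intro q hq
    have h1 : outerNormal W q ∈ X := by
      rw [hX]; exact Submodule.subset_span (mem_image_of_mem _ hq)
    rw [outerNormal] at h1
    exact (X.smul_mem_iff (inv_ne_zero (hC.gradient_frontier hW h0 hq).2.2.1.ne')).1 h1
  -- The points `x k` may be unbounded; their projections are bounded and have the same gauge and
  -- gradients.
  set u : ℕ → EuclideanSpace ℝ (Fin n) := fun k => X.starProjection (x k) with hu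
  have hgu : ∀ q ∈ frontier W, ∀ k, ⟪∇ (gauge W) q, u k⟫_ℝ = ⟪∇ (gauge W) q, x k⟫_ℝ := by
    intro q hq k
    exact Submodule.inner_orthogonalProjectionOnto_eq_of_mem_left (⟨_, hX' q hq⟩ : X) (x k)
  have hu1 : ∀ k, gauge W (u k) = 1 := fun k => by
    rw [hu, gauge_starProjection_eq hC hW h0 hX, (hC.gradient_frontier hW h0 (hx k)).1]
  have hgxu : ∀ k, ∇ (gauge W) (x k) = ∇ (gauge W) (u k) := fun k => by
    obtain ⟨-, h2, -, h4⟩ := hC.gradient_frontier hW h0 (hx k)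
    exact (hC.hasGradientAt hW h0 (x := u k) (by rw [hu1]; exact one_ne_zero)).eq_of_support h4
      (by rw [hgu _ (hx k), h2, hu1])
  obtain ⟨B, hB0, hB⟩ := hC.exists_norm_gradient_le hW h0
  have hlim' : Tendsto (fun k => ⟪∇ (gauge W) (z k), u k⟫_ℝ - 1) atTop (𝓝 0) := by
    have h1 : Tendsto (fun k => B * |⟪outerNormal W (z k), x k - z k⟫_ℝ|) atTop (𝓝 0) := by
      simpa using hlim.abs.const_mul B
    refine squeeze_zero_norm (fun k => ?_) h1
    have hp := (hC.gradient_frontier hW h0 (hz k)).2.2.1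
    rw [inner_outerNormal_sub hC hW h0 (hz k), hgu _ (hz k), abs_mul, abs_inv, abs_norm,
      Real.norm_eq_abs, ← mul_assoc, ← div_eq_mul_inv]
    exact le_mul_of_one_le_left (abs_nonneg _) ((one_le_div hp).2 (hB _ (hz k)))
  obtain ⟨R, hR⟩ := hb.exists_norm_le
  have hub : ∀ k, u k ∈ Metric.closedBall 0 R := fun k => by
    rw [mem_closedBall_zero_iff]; exact hR _ (mem_range_self k)
  refine tendsto_of_subseq_tendsto fun ns hns => ?_
  obtain ⟨v, -, ψ, hψ, hv⟩ :=
    (isCompact_closedBall (0 : EuclideanSpace ℝ (Fin n)) R).tendsto_subseq fun k => hub (ns k)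
  obtain ⟨g, -, χ, hχ, hg⟩ :=
    (isCompact_closedBall (0 : EuclideanSpace ℝ (Fin n)) B).tendsto_subseq
      (x := fun k => ∇ (gauge W) (z (ns (ψ k))))
      fun k => by rw [mem_closedBall_zero_iff]; exact hB _ (hz _)
  have hv' := hv.comp hχ.tendsto_atTop
  have hsub : Tendsto (fun k => ns (ψ (χ k))) atTop atTop :=
    hns.comp (hψ.tendsto_atTop.comp hχ.tendsto_atTop)
  have hμ := continuous_gauge_of_zero_mem_interior hW h0
  have hv1 : gauge W v = 1 :=
    tendsto_nhds_unique ((hμ.tendsto v).comp hv') (by simp [Function.comp_def, hu1])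
  have hvne : gauge W v ≠ 0 := by rw [hv1]; exact one_ne_zero
  have hgrad := hC.hasGradientAt hW h0 hvne
  have hgv : ⟪g, v⟫_ℝ = 1 := by
    have h1 : Tendsto (fun k => ⟪∇ (gauge W) (z (ns (ψ (χ k)))), u (ns (ψ (χ k)))⟫_ℝ) atTop
        (𝓝 1) := by simpa using (hlim'.comp hsub).add_const 1
    exact tendsto_nhds_unique (hg.inner hv') h1
  have hgle : ∀ y, ⟪g, y⟫_ℝ ≤ gauge W y := fun y =>
    le_of_tendsto (hg.inner tendsto_const_nhds)
      (Eventually.of_forall fun k => (hC.gradient_frontier hW h0 (hz _)).2.2.2 y)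
  -- No limit of the `z k` is needed: their gradients converge to a functional supporting at `v`,
  -- which is unique.
  have hgeq : g = ∇ (gauge W) v := hgrad.eq_of_support hgle (by rw [hgv, hv1])
  have hgne : ‖g‖ ≠ 0 := by
    rw [norm_ne_zero_iff]; rintro rfl; simp at hgv
  have hgx : Tendsto (fun k => ∇ (gauge W) (x (ns (ψ (χ k))))) atTop (𝓝 g) := by
    simp only [hgxu]
    rw [hgeq]
    exact (hC.continuousAt_gradient hW h0 hvne).tendsto.comp hv'
  refine ⟨fun k => ψ (χ k), ?_⟩
  have hnz := (hg.norm.inv₀ hgne).smul hg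
  have hnx := (hgx.norm.inv₀ hgne).smul hgx
  simpa [outerNormal] using (hnz.sub hnx).norm

/-- Points escaping a body of class `C¹` in the directions of its normals. -/
theorem exists_projCone_disjoint (hC : IsClassC1 W) (hW : Convex ℝ W) (h0 : 0 ∈ interior W)
    {X Y : Submodule ℝ (EuclideanSpace ℝ (Fin n))}
    (hX : X = Submodule.span ℝ (outerNormal W '' frontier W)) (hY : Y ≤ X) :
    ∃ (w p : Fin (Module.finrank ℝ X - Module.finrank ℝ Y) → EuclideanSpace ℝ (Fin n)) (ε : ℝ),
      LinearIndependent ℝ w ∧ (∀ j, ‖w j‖ = 1) ∧ (∀ j, w j ∈ X ⊓ Yᗮ) ∧ 0 < ε ∧ ε < 1 ∧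
      ∀ j, ∀ x ∈ W, x ∉ projCone Y ε (w j) (p j) := by
  obtain ⟨ν, hν, hli⟩ := exists_linearIndependent_orthogonal_components hX hY
  choose q hq hqν using hν
  set f := fun i => Yᗮ.starProjection (ν i) with hf
  have hfpos : ∀ i, 0 < ‖f i‖ := fun i => norm_pos_iff.2 (hli.ne_zero i)
  have hfY : ∀ i, f i ∈ Yᗮ := fun i => Submodule.starProjection_apply_mem _ _
  have hfeq : ∀ i, ν i = Y.starProjection (ν i) + f i := fun i =>
    (Y.starProjection_add_starProjection_orthogonal (ν i)).symm
  have hfX : ∀ i, f i ∈ X := fun i => by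
    have h1 : ν i ∈ X := by
      rw [hX, ← hqν]; exact Submodule.subset_span (mem_image_of_mem _ (hq i))
    rw [eq_sub_of_add_eq' (hfeq i).symm]
    exact X.sub_mem h1 (hY (Submodule.starProjection_apply_mem _ _))
  have hν1 : ∀ i, ‖ν i‖ = 1 := fun i => by
    rw [← hqν, outerNormal, norm_smul, norm_inv, norm_norm,
      inv_mul_cancel₀ (hC.gradient_frontier hW h0 (hq i)).2.2.1.ne']
  set h := fun i => ‖∇ (gauge W) (q i)‖⁻¹ with hh
  have hhpos : ∀ i, 0 < h i := fun i => inv_pos.2 (hC.gradient_frontier hW h0 (hq i)).2.2.1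
  have hνW : ∀ i, ∀ x ∈ W, ⟪ν i, x⟫_ℝ ≤ h i := by
    intro i x hx
    rw [← hqν, outerNormal, real_inner_smul_left]
    have h1 := ((hC.gradient_frontier hW h0 (hq i)).2.2.2 x).trans (gauge_le_one_of_mem hx)
    exact mul_le_of_le_one_right (hhpos i).le h1
  obtain ⟨ε, ⟨hε1, hεf⟩, hε0⟩ : ∃ ε : ℝ, (ε < 1 ∧ ∀ i, ε < ‖f i‖ / 2) ∧ 0 < ε := by
    have h1 : ∀ᶠ ε : ℝ in 𝓝[>] 0, ε < 1 ∧ ∀ i, ε < ‖f i‖ / 2 :=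
      nhdsWithin_le_nhds ((gt_mem_nhds one_pos).and
        (eventually_all.2 fun i => gt_mem_nhds (half_pos (hfpos i))))
    exact (h1.and self_mem_nhdsWithin).exists
  set w := fun i => ‖f i‖⁻¹ • f i with hw
  -- On the cone with apex `t i • w i`, the `Y`-part costs at most half of `‖f i‖ * (⟪w i, x⟫ - t
  -- i)`, as `ε < ‖f i‖ / 2`. Hence `⟪ν i, x⟫ ≥ 2 * h i + 1`, above the bound `h i` valid on `W`.
  set t := fun i => (2 * h i + 1) / ‖f i‖ with ht
  have hw1 : ∀ i, ‖w i‖ = 1 := fun i => by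
    rw [hw, norm_smul, norm_inv, norm_norm, inv_mul_cancel₀ (hfpos i).ne']
  have hwY : ∀ i, w i ∈ Yᗮ := fun i => Submodule.smul_mem _ _ (hfY i)
  refine ⟨w, fun i => t i • w i, ε, ?_, hw1,
    fun i => ⟨X.smul_mem _ (hfX i), hwY i⟩, hε0, hε1, fun i x hx hxV => ?_⟩
  · exact hli.units_smul fun i => Units.mk0 (‖f i‖⁻¹) (inv_ne_zero (hfpos i).ne')
  · have hti : 0 < t i := div_pos (by linarith [hhpos i]) (hfpos i)
    rw [projCone, mem_ofPred_eq, map_sub, map_smul,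
      Submodule.orthogonalProjectionOnto_apply_of_mem_orthogonal (hwY i), smul_zero,
      sub_zero, inner_sub_right, inner_smul_right, real_inner_self_eq_norm_sq, hw1, one_pow,
      mul_one] at hxV
    have h1 : ⟪ν i, x⟫_ℝ = ⟪Y.starProjection (ν i), Y.starProjection x⟫_ℝ +
        ‖f i‖ * ⟪w i, x⟫_ℝ := by
      conv_lhs => rw [hfeq i]
      rw [inner_add_left, hw, real_inner_smul_left, mul_inv_cancel_left₀ (hfpos i).ne']
      congr 1
      exact (Submodule.inner_orthogonalProjectionOnto_eq_of_mem_left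
        (Y.orthogonalProjectionOnto (ν i)) x).symm
    have h2 : -‖Y.orthogonalProjectionOnto x‖ ≤
        ⟪Y.starProjection (ν i), Y.starProjection x⟫_ℝ := by
      have h3 := abs_real_inner_le_norm (Y.starProjection (ν i)) (Y.starProjection x)
      have h4 : ‖Y.starProjection (ν i)‖ ≤ 1 :=
        (Y.norm_orthogonalProjectionOnto_apply_le (ν i)).trans (hν1 i).le
      have h5 : ‖Y.starProjection x‖ = ‖Y.orthogonalProjectionOnto x‖ := rfl
      rw [← h5]
      linarith [(abs_le.1 h3).1, mul_le_of_le_one_left (norm_nonneg (Y.starProjection x)) h4]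
    have h6 : t i ≤ ⟪w i, x⟫_ℝ := by
      have := (norm_nonneg _).trans hxV
      have := nonneg_of_mul_nonneg_right this hε0
      linarith
    have h7 : ε * (⟪w i, x⟫_ℝ - t i) ≤ ‖f i‖ / 2 * (⟪w i, x⟫_ℝ - t i) :=
      mul_le_mul_of_nonneg_right (hεf i).le (by linarith)
    have h8 : ‖f i‖ * t i = 2 * h i + 1 := by
      rw [ht]; field_simp [(hfpos i).ne']
    have h9 : ‖f i‖ * t i ≤ ‖f i‖ * ⟪w i, x⟫_ℝ := mul_le_mul_of_nonneg_left h6 (hfpos i).le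
    linarith [hνW i x hx, hhpos i]

end Necessity

/-! ### Completing the span, and lifting a body from the subspace. -/

section Sufficiency

/-- Points outside of suitable cones are bounded in enough directions to complete
`G` to a spanning set of `X`. -/
theorem exists_finite_complement {n : ℕ} {E G : Set (EuclideanSpace ℝ (Fin n))}
    {X Y : Submodule ℝ (EuclideanSpace ℝ (Fin n))} (hY : Submodule.span ℝ G = Y) (hGX : Y ≤ X)
    (hE : ∀ x ∈ E, ∀ g ∈ G, ⟪g, x⟫_ℝ ≤ 1)
    (h : Y ≠ X →
      ∃ (w p : Fin (Module.finrank ℝ X - Module.finrank ℝ Y) →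
          EuclideanSpace ℝ (Fin n)) (ε : ℝ),
        LinearIndependent ℝ w ∧ (∀ j, w j ∈ X ⊓ Yᗮ) ∧ 0 < ε ∧
        ∀ j, ∀ x ∈ E, x ∉ projCone Y ε (w j) (p j)) :
    ∃ J : Set (EuclideanSpace ℝ (Fin n)), J.Finite ∧ J ⊆ X ∧ Submodule.span ℝ (G ∪ J) = X ∧
      ∀ x ∈ E, ∀ g ∈ J, ⟪g, x⟫_ℝ ≤ 1 / 2 := by
  by_cases hX : Y = X
  · exact ⟨∅, finite_empty, empty_subset _, by rw [union_empty, hY, hX], by simp⟩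
  obtain ⟨w, p, ε, hli, hwX, hε, hcone⟩ := h hX
  obtain ⟨a, ha, C, haC⟩ : ∃ a ∈ Y, ∃ C : ℝ, ∀ s, (∀ g ∈ G, ⟪g, s⟫_ℝ ≤ 1) →
      ‖Y.orthogonalProjectionOnto s‖ ≤ ⟪a, s⟫_ℝ + C := by
    subst hY
    exact exists_norm_orthogonalProjectionOnto_le G
  simp only [Submodule.span_union, hY]
  set B := fun j => C + ‖Y.orthogonalProjectionOnto (p j)‖ + ε * ⟪w j, p j⟫_ℝ with hB
  set D := fun j => 2 * (|B j| + 1) with hD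
  have hDpos : ∀ j, 0 < D j := fun j => by positivity
  -- Outside the cone, `ε * ⟪w j, x - p j⟫` is less than the norm of the projection of `x - p j`,
  -- which `a` dominates up to constants. So `ε • w j - a` is bounded above by `B j` on `E`;
  -- dividing by `D j` makes the bound 1/2. As `a ∈ Y`, these still recover `w j` modulo `Y`.
  set g := fun j => (D j)⁻¹ • (ε • w j - a) with hg
  have hgX : range g ⊆ X := by
    rintro _ ⟨j, rfl⟩
    exact X.smul_mem _ (X.sub_mem (X.smul_mem _ (hwX j).1) (hGX ha))
  refine ⟨range g, finite_range g, hgX, le_antisymm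
    (sup_le hGX (Submodule.span_le.2 hgX)) ?_, ?_⟩
  · have hspan : Submodule.span ℝ (range w) = Yᗮ ⊓ X := by
      apply Submodule.eq_of_le_of_finrank_eq
      · rw [Submodule.span_le]
        rintro _ ⟨j, rfl⟩
        exact ⟨(hwX j).2, (hwX j).1⟩
      · rw [finrank_span_eq_card hli, Fintype.card_fin]
        have := Submodule.finrank_add_inf_finrank_orthogonal hGX
        omega
    have hsup := Submodule.sup_orthogonal_inf_of_hasOrthogonalProjection hGX
    rw [← hspan] at hsup
    refine hsup.ge.trans ?_
    refine sup_le le_sup_left (Submodule.span_le.2 ?_)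
    rintro _ ⟨j, rfl⟩
    have h1 : w j = ε⁻¹ • (D j • g j + a) := by
      simp only [hg]
      rw [smul_inv_smul₀ (hDpos j).ne', sub_add_cancel, inv_smul_smul₀ hε.ne']
    rw [h1]
    refine Submodule.smul_mem _ _ (Submodule.add_mem _ (Submodule.smul_mem _ _ ?_) ?_)
    · exact Submodule.mem_sup_right (Submodule.subset_span (mem_range_self j))
    · exact Submodule.mem_sup_left ha
  · rintro x hx _ ⟨j, rfl⟩
    have h1 := hcone j x hx
    rw [projCone, mem_ofPred_eq, not_le, map_sub, inner_sub_right] at h1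
    have h2 := norm_sub_le (Y.orthogonalProjectionOnto x) (Y.orthogonalProjectionOnto (p j))
    have h3 := haC x (hE x hx)
    simp only [hg]
    rw [real_inner_smul_left, inner_sub_left, real_inner_smul_left, inv_mul_le_iff₀ (hDpos j)]
    have h4 : ε * ⟪w j, x⟫_ℝ - ⟪a, x⟫_ℝ ≤ B j := by
      simp only [hB]; linarith
    have h5 : D j * (1 / 2) = |B j| + 1 := by simp only [hD]; ring
    rw [h5]
    linarith [le_abs_self (B j)]

/-- The preimage under the orthogonal projection onto `X` of a `C¹` convex body in `X`. -/
theorem exists_body_of_subspace_body {n : ℕ} {X : Submodule ℝ (EuclideanSpace ℝ (Fin n))}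
    {K : Set X} (hspan : Submodule.span ℝ K = ⊤) {B : Set X} (hcl : IsClosed B)
    (hconv : Convex ℝ B) (h0 : 0 ∈ interior B)
    (hC : ContDiffOn ℝ 1 (gauge B) (gauge B ⁻¹' {0})ᶜ) (hBK : ∀ s ∈ B, ∀ g ∈ K, ⟪g, s⟫_ℝ ≤ 1) :
    ∃ W : Set (EuclideanSpace ℝ (Fin n)), IsConvexBody W ∧ 0 ∈ interior W ∧ IsClassC1 W ∧
      X = Submodule.span ℝ (outerNormal W '' frontier W) ∧
      ∀ (x : EuclideanSpace ℝ (Fin n)) (g : X), gauge B (X.orthogonalProjectionOnto x) = 1 →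
        HasGradientAt (gauge B) g (X.orthogonalProjectionOnto x) →
        x ∈ frontier W ∧ outerNormal W x = ‖g‖⁻¹ • (g : EuclideanSpace ℝ (Fin n)) := by
  set P := X.orthogonalProjectionOnto with hP
  set W : Set (EuclideanSpace ℝ (Fin n)) := P ⁻¹' B with hWdef
  have hgauge : gauge W = gauge B ∘ P := by
    funext x
    simp only [Function.comp_apply, gauge_def', hWdef, mem_preimage, map_smul]
  have hWconv : Convex ℝ W := hconv.is_linear_preimage ⟨map_add P, map_smul P⟩
  have hW0 : (0 : EuclideanSpace ℝ (Fin n)) ∈ interior W := by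
    rw [mem_interior_iff_mem_nhds] at h0 ⊢
    exact P.continuous.continuousAt.preimage_mem_nhds (by simpa using h0)
  have hWC : IsClassC1 W := by
    rw [IsClassC1, hgauge]
    exact hC.comp P.contDiff.contDiffOn fun x hx => hx
  have hgrad : ∀ (x : EuclideanSpace ℝ (Fin n)) (g : X), HasGradientAt (gauge B) g (P x) →
      HasGradientAt (gauge W) (g : EuclideanSpace ℝ (Fin n)) x := by
    intro x g hg
    rw [hasGradientAt_iff_hasFDerivAt, hgauge]
    have h1 := hg.hasFDerivAt.comp x P.hasFDerivAt
    refine h1.congr_fderiv ?_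
    ext v
    simp [hP]
  have hfr : ∀ x, x ∈ frontier W ↔ gauge B (P x) = 1 := fun x => by
    rw [← gauge_eq_one_iff_mem_frontier hWconv (mem_interior_iff_mem_nhds.1 hW0), hgauge]
    rfl
  have hout : ∀ (x : EuclideanSpace ℝ (Fin n)) (g : X), HasGradientAt (gauge B) g (P x) →
      outerNormal W x = ‖g‖⁻¹ • (g : EuclideanSpace ℝ (Fin n)) := fun x g hg => by
    rw [outerNormal, (hgrad x g hg).gradient, Submodule.coe_norm]
  refine ⟨W, ⟨hcl.preimage P.continuous, hWconv, ⟨0, hW0⟩⟩, hW0, hWC, ?_,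
    fun x g h1 hg => ⟨(hfr x).2 h1, hout x g hg⟩⟩
  have hle : Submodule.span ℝ (outerNormal W '' frontier W) ≤ X := by
    rw [Submodule.span_le]
    rintro _ ⟨x, hx, rfl⟩
    have ho : IsOpen (gauge B ⁻¹' {0})ᶜ :=
      (isClosed_singleton.preimage (continuous_gauge_of_zero_mem_interior hconv h0)).isOpen_compl
    have hmem : P x ∈ (gauge B ⁻¹' {0})ᶜ := by
      rw [mem_compl_iff, mem_preimage, mem_singleton_iff, (hfr x).1 hx]; exact one_ne_zero
    have hd := ((hC.contDiffAt (ho.mem_nhds hmem)).differentiableAt one_ne_zero).hasGradientAt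
    rw [hout x _ hd]
    exact X.smul_mem _ (Subtype.coe_prop _)
  -- A vector of `X` orthogonal to all normals has gauge 0, so its whole line lies in `W`.
  -- Functionals of `K` are bounded above on that line, hence vanish on it, and `K` spans.
  have hbot : (Submodule.span ℝ (outerNormal W '' frontier W))ᗮ ⊓ X = ⊥ := by
    rw [eq_bot_iff]
    rintro v ⟨hv, hvX⟩
    have hz : ∀ t : ℝ, t • v ∈ W := fun t => by
      have h1 : gauge W (t • v) = 0 :=
        gauge_eq_zero_of_mem_orthogonal hWC hWconv hW0 fun q hq =>
          Submodule.inner_right_of_mem_orthogonal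
            (Submodule.subset_span (mem_image_of_mem _ hq)) (Submodule.smul_mem _ t hv)
      have h2 := (gauge_le_one_iff_mem_closure hWconv (mem_interior_iff_mem_nhds.1 hW0)).1
        (h1.le.trans zero_le_one)
      rwa [(hcl.preimage P.continuous).closure_eq] at h2
    have hgv : ∀ g ∈ K, ⟪g, P v⟫_ℝ = 0 := by
      intro g hg
      by_contra hne
      have h1 := hBK _ (hz (2 / ⟪g, P v⟫_ℝ)) g hg
      rw [hP, Submodule.inner_orthogonalProjectionOnto_eq_of_mem_left, inner_smul_right,
        ← Submodule.inner_orthogonalProjectionOnto_eq_of_mem_left, div_mul_cancel₀ _ hne] at h1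
      norm_num at h1
    have hPv : P v = 0 := by
      have h1 : P v ∈ (Submodule.span ℝ K)ᗮ :=
        (Submodule.mem_orthogonal _ _).2 fun u hu => by
          induction hu using Submodule.span_induction with
          | mem g hg => exact hgv g hg
          | zero => simp
          | add x y _ _ hx hy => rw [inner_add_left, hx, hy, add_zero]
          | smul c x _ hx => rw [real_inner_smul_left, hx, mul_zero]
      rwa [hspan, Submodule.top_orthogonal_eq_bot, Submodule.mem_bot] at h1
    rw [Submodule.mem_bot]
    have h2 : X.starProjection v = v := Submodule.starProjection_eq_self_iff.2 hvX
    rw [← h2, Submodule.starProjection_apply, ← hP, hPv, Submodule.coe_zero]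
  have h3 := Submodule.sup_orthogonal_inf_of_hasOrthogonalProjection hle
  rw [hbot, sup_bot_eq] at h3
  exact h3.symm

end Sufficiency

/-! ### From the four conditions to the body. -/

section Main

theorem span_range_smul_eq {ι V : Type*} [AddCommGroup V] [Module ℝ V] {c : ι → ℝ}
    (hc : ∀ i, c i ≠ 0) (v : ι → V) :
    Submodule.span ℝ (range fun i => c i • v i) = Submodule.span ℝ (range v) := by
  apply le_antisymm <;> rw [Submodule.span_le] <;> rintro _ ⟨i, rfl⟩
  · exact Submodule.smul_mem _ _ (Submodule.subset_span (mem_range_self i))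
  · rw [← inv_smul_smul₀ (hc i) (v i)]
    exact Submodule.smul_mem _ _ (Submodule.subset_span ⟨i, rfl⟩)

theorem EReal.exists_pos_le_of_iInf_pos {ι : Type*} {f : ι → ℝ}
    (h : 0 < ⨅ i, ((f i : ℝ) : EReal)) : ∃ r : ℝ, 0 < r ∧ ∀ i, r ≤ f i := by
  obtain ⟨r, hr0, hr⟩ := EReal.lt_iff_exists_real_btwn.1 h
  exact ⟨r, EReal.coe_pos.1 hr0, fun i => EReal.coe_le_coe_iff.1 (hr.le.trans (iInf_le _ i))⟩

variable {n : ℕ} {E : Set (EuclideanSpace ℝ (Fin n))}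
  {N : E → Metric.sphere (0 : EuclideanSpace ℝ (Fin n)) 1}
  {X : Submodule ℝ (EuclideanSpace ℝ (Fin n))}

/-- The functionals `N y / ⟨N y, y⟩` have at most one limit point that touches the closure of
the projection of `E` at a given point. -/
theorem existsUnique_limit_functional (hNX : ∀ y, (N y : EuclideanSpace ℝ (Fin n)) ∈ X)
    {h : E → ℝ} (hh : ∀ y, h y = ⟪(N y : EuclideanSpace ℝ (Fin n)), (y : _)⟫_ℝ) {r : ℝ}
    (hr : 0 < r) (hrh : ∀ y, r ≤ h y) {g : E → X}
    (hg : ∀ y, (g y : EuclideanSpace ℝ (Fin n)) = (h y)⁻¹ • (N y : EuclideanSpace ℝ (Fin n)))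
    (hasymp : ∀ x z : ℕ → E,
      Bornology.IsBounded
        (range fun k => X.orthogonalProjectionOnto (x k : EuclideanSpace ℝ (Fin n))) →
      Tendsto (fun k => ⟪(N (z k) : EuclideanSpace ℝ (Fin n)),
        (x k : EuclideanSpace ℝ (Fin n)) - z k⟫_ℝ) atTop (𝓝 0) →
      Tendsto (fun k => ‖(N (z k) : EuclideanSpace ℝ (Fin n)) - N (x k)‖) atTop (𝓝 0))
    {x : X} (hx : x ∈ closure (range fun y : E =>
      X.orthogonalProjectionOnto (y : EuclideanSpace ℝ (Fin n)))) :
    ∃ g₀ ∈ closure (range g), ⟪g₀, x⟫_ℝ = 1 ∧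
      ∀ g' ∈ closure (range g), ⟪g', x⟫_ℝ = 1 → g' = g₀ := by
  have hpos : ∀ y, 0 < h y := fun y => hr.trans_le (hrh y)
  have hN1 : ∀ y, ‖(N y : EuclideanSpace ℝ (Fin n))‖ = 1 := fun y => by simp
  have hgP : ∀ y (v : EuclideanSpace ℝ (Fin n)), ⟪g y, X.orthogonalProjectionOnto v⟫_ℝ =
      (h y)⁻¹ * ⟪(N y : EuclideanSpace ℝ (Fin n)), v⟫_ℝ := fun y v => by
    rw [Submodule.inner_orthogonalProjectionOnto_eq_of_mem_left, hg, real_inner_smul_left]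
  have hgn : ∀ y, ‖g y‖ = (h y)⁻¹ := fun y => by
    rw [Submodule.coe_norm, hg, norm_smul, hN1, mul_one, Real.norm_of_nonneg
      (inv_nonneg.2 (hpos y).le)]
  have hgy : ∀ y, ‖g y‖⁻¹ • g y = (⟨N y, hNX y⟩ : X) := fun y => by
    ext1
    rw [hgn, inv_inv, Submodule.coe_smul, hg, smul_inv_smul₀ (hpos y).ne']
  obtain ⟨u, hu, hux⟩ := mem_closure_iff_seq_limit.1 hx
  choose y hy using hu
  simp only at hy
  have hyx : Tendsto (fun k => X.orthogonalProjectionOnto (y k : EuclideanSpace ℝ (Fin n)))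
      atTop (𝓝 x) := by simpa only [hy] using hux
  have hyb := Metric.isBounded_range_of_tendsto _ hyx
  -- Any limit functional touching at `x` forces `N (y k)` to converge to its direction. The
  -- sequence `y` does not depend on `g'`, so the direction is unique, and the value 1 at `x` then
  -- fixes the length.
  have hlimN : ∀ g' ∈ closure (range g), ⟪g', x⟫_ℝ = 1 →
      Tendsto (fun k => (⟨N (y k), hNX (y k)⟩ : X)) atTop (𝓝 (‖g'‖⁻¹ • g')) := by
    intro g' hg' hg'x
    obtain ⟨v, hv, hvg⟩ := mem_closure_iff_seq_limit.1 hg'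
    choose z hz using hv
    have hzg : Tendsto (fun k => g (z k)) atTop (𝓝 g') := by simpa only [hz] using hvg
    have hg'0 : ‖g'‖ ≠ 0 := by
      rw [norm_ne_zero_iff]; rintro rfl; simp at hg'x
    have h1 : Tendsto (fun k => ‖g (z k)‖⁻¹ *
        (⟪g (z k), X.orthogonalProjectionOnto (y k : EuclideanSpace ℝ (Fin n))⟫_ℝ - 1)) atTop
        (𝓝 0) := by
      have := (hzg.norm.inv₀ hg'0).mul ((hzg.inner hyx).sub_const 1)
      rwa [hg'x, sub_self, mul_zero] at this
    have h2 := hasymp y z hyb (h1.congr fun k => by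
      have h3 := (hpos (z k)).ne'
      rw [hgn, hgP, inv_inv, inner_sub_right, ← hh]
      field_simp)
    have h4 : Tendsto (fun k => (⟨N (z k), hNX (z k)⟩ : X)) atTop (𝓝 (‖g'‖⁻¹ • g')) := by
      simpa only [hgy] using (hzg.norm.inv₀ hg'0).smul hzg
    have h5 : Tendsto (fun k => (⟨N (z k), hNX (z k)⟩ : X) - ⟨N (y k), hNX (y k)⟩) atTop
        (𝓝 0) := by
      rw [tendsto_zero_iff_norm_tendsto_zero]
      exact h2
    simpa using h4.sub h5
  have hgb : ∀ k, g (y k) ∈ Metric.closedBall (0 : X) r⁻¹ := fun k => by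
    rw [mem_closedBall_zero_iff, hgn]
    exact inv_anti₀ hr (hrh _)
  obtain ⟨g₀, -, ψ, hψ, hg₀⟩ := (isCompact_closedBall (0 : X) r⁻¹).tendsto_subseq hgb
  have hg₀x : ⟪g₀, x⟫_ℝ = 1 := by
    refine tendsto_nhds_unique (hg₀.inner (hyx.comp hψ.tendsto_atTop)) ?_
    refine tendsto_const_nhds.congr fun k => ?_
    simp only [Function.comp_apply]
    rw [hgP, ← hh, inv_mul_cancel₀ (hpos _).ne']
  have hg₀mem : g₀ ∈ closure (range g) :=
    mem_closure_of_tendsto hg₀ (Eventually.of_forall fun k => mem_range_self _)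
  refine ⟨g₀, hg₀mem, hg₀x, fun g' hg' hg'x => ?_⟩
  have h1 := tendsto_nhds_unique (hlimN g' hg' hg'x) (hlimN g₀ hg₀mem hg₀x)
  have h2 : ‖g'‖⁻¹ = ‖g₀‖⁻¹ := by
    have key : ∀ v : X, ⟪v, x⟫_ℝ = 1 → ⟪‖v‖⁻¹ • v, x⟫_ℝ = ‖v‖⁻¹ := fun v hv =>
      (real_inner_smul_left v x _).trans (by rw [hv, mul_one])
    rw [← key g' hg'x, h1, key g₀ hg₀x]
  have h3 : ‖g₀‖⁻¹ ≠ 0 := by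
    refine inv_ne_zero (norm_ne_zero_iff.2 ?_); rintro rfl; simp at hg₀x
  rw [h2] at h1
  exact smul_right_injective _ h3 h1

/-- The contact problem is solved in `X` for the closures of the projected points and of the
functionals `g`, then pulled back. The added functionals stay below 1/2 on `E`, so they create no
new contacts. -/
theorem exists_body_of_conditions
    (h1 : ∀ x y : E, ⟪(N y : EuclideanSpace ℝ (Fin n)), (x : EuclideanSpace ℝ (Fin n)) - y⟫_ℝ ≤ 0)
    (hasymp : ∀ x z : ℕ → E,
      Bornology.IsBounded
        (range fun k => X.orthogonalProjectionOnto (x k : EuclideanSpace ℝ (Fin n))) →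
      Tendsto (fun k => ⟪(N (z k) : EuclideanSpace ℝ (Fin n)),
        (x k : EuclideanSpace ℝ (Fin n)) - z k⟫_ℝ) atTop (𝓝 0) →
      Tendsto (fun k => ‖(N (z k) : EuclideanSpace ℝ (Fin n)) - N (x k)‖) atTop (𝓝 0))
    {r : ℝ} (hr : 0 < r)
    (hrh : ∀ y : E, r ≤ ⟪(N y : EuclideanSpace ℝ (Fin n)), (y : EuclideanSpace ℝ (Fin n))⟫_ℝ)
    (hYX : normalSpan N ≤ X)
    (hcone : normalSpan N ≠ X →
      ∃ (w p : Fin (Module.finrank ℝ X - Module.finrank ℝ (normalSpan N)) →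
          EuclideanSpace ℝ (Fin n)) (ε : ℝ),
        LinearIndependent ℝ w ∧ (∀ j, w j ∈ X ⊓ (normalSpan N)ᗮ) ∧ 0 < ε ∧
        ∀ j, ∀ x ∈ E, x ∉ projCone (normalSpan N) ε (w j) (p j)) :
    ∃ W : Set (EuclideanSpace ℝ (Fin n)),
      IsConvexBody W ∧ 0 ∈ interior W ∧ IsClassC1 W ∧ E ⊆ frontier W ∧
      (∀ x : E, (N x : EuclideanSpace ℝ (Fin n)) = outerNormal W x) ∧
      X = Submodule.span ℝ (outerNormal W '' frontier W) := by
  have hNX : ∀ y, (N y : EuclideanSpace ℝ (Fin n)) ∈ X := fun y =>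
    hYX (Submodule.subset_span (mem_range_self y))
  set h : E → ℝ := fun y => ⟪(N y : EuclideanSpace ℝ (Fin n)), (y : _)⟫_ℝ with hh
  have hpos : ∀ y, 0 < h y := fun y => hr.trans_le (hrh y)
  have hN1 : ∀ y, ‖(N y : EuclideanSpace ℝ (Fin n))‖ = 1 := fun y => by simp
  set γ : E → EuclideanSpace ℝ (Fin n) :=
    fun y => (h y)⁻¹ • (N y : EuclideanSpace ℝ (Fin n)) with hγ
  set g : E → X := fun y => ⟨γ y, X.smul_mem _ (hNX y)⟩ with hg
  have hγspan : Submodule.span ℝ (range γ) = normalSpan N :=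
    span_range_smul_eq (fun y => inv_ne_zero (hpos y).ne') _
  have hγle : ∀ x ∈ E, ∀ v ∈ range γ, ⟪v, x⟫_ℝ ≤ 1 := by
    rintro x hx _ ⟨y, rfl⟩
    have := h1 ⟨x, hx⟩ y
    rw [inner_sub_right] at this
    rw [hγ, real_inner_smul_left, inv_mul_le_iff₀ (hpos y), mul_one]
    exact sub_nonpos.1 this
  obtain ⟨J, hJfin, hJX, hJspan, hJle⟩ := exists_finite_complement hγspan hYX hγle hcone
  set JX : Set X := ((↑) : X → EuclideanSpace ℝ (Fin n)) ⁻¹' J with hJXdef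
  set K : Set X := insert 0 (closure (range g) ∪ JX) with hK
  set A : Set X := closure (range fun y : E =>
      X.orthogonalProjectionOnto (y : EuclideanSpace ℝ (Fin n))) with hA
  have hgle : ∀ x ∈ A, ∀ v ∈ closure (range g), ⟪v, x⟫_ℝ ≤ 1 := by
    intro x hx v hv
    refine closure_minimal (t := {v : X | ⟪v, x⟫_ℝ ≤ 1}) ?_
      (isClosed_le (by fun_prop) (by fun_prop)) hv
    rintro _ ⟨y, rfl⟩
    refine closure_minimal (t := {x : X | ⟪g y, x⟫_ℝ ≤ 1}) ?_
      (isClosed_le (by fun_prop) (by fun_prop)) hx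
    rintro _ ⟨z, rfl⟩
    rw [mem_ofPred_eq, Submodule.inner_orthogonalProjectionOnto_eq_of_mem_left]
    exact hγle z z.2 _ (mem_range_self y)
  have hJle' : ∀ x ∈ A, ∀ v ∈ JX, ⟪v, x⟫_ℝ ≤ 1 / 2 := by
    intro x hx v hv
    refine closure_minimal (t := {x : X | ⟪v, x⟫_ℝ ≤ 1 / 2}) ?_
      (isClosed_le (by fun_prop) (by fun_prop)) hx
    rintro _ ⟨z, rfl⟩
    rw [mem_ofPred_eq, Submodule.inner_orthogonalProjectionOnto_eq_of_mem_left]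
    exact hJle z z.2 _ hv
  have hKcompact : IsCompact K := by
    refine IsCompact.insert (IsCompact.union ?_ ?_) 0
    · refine (isCompact_closedBall (0 : X) r⁻¹).of_isClosed_subset isClosed_closure
        (closure_minimal ?_ Metric.isClosed_closedBall)
      rintro _ ⟨y, rfl⟩
      rw [mem_closedBall_zero_iff, Submodule.coe_norm]
      simp only [hg, hγ]
      rw [norm_smul, hN1, mul_one, Real.norm_of_nonneg (inv_nonneg.2 (hpos y).le)]
      exact inv_anti₀ hr (hrh y)
    · exact (hJfin.preimage Subtype.coe_injective.injOn).isCompact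
  have hspan : Submodule.span ℝ K = ⊤ := by
    have hsub : Submodule.span ℝ (range g ∪ JX) = ⊤ := by
      apply Submodule.map_injective_of_injective X.injective_subtype
      rw [Submodule.map_span, Submodule.map_top, Submodule.range_subtype, image_union, ← range_comp]
      refine Eq.trans ?_ hJspan
      congr 2
      exact Subtype.image_preimage_coe _ _ |>.trans (inter_eq_right.2 hJX)
    rw [eq_top_iff, ← hsub]
    exact Submodule.span_mono
      ((union_subset_union_left _ subset_closure).trans (subset_insert _ _))
  have huniq : ∀ x ∈ A, ∃ v ∈ K, ⟪v, x⟫_ℝ = 1 ∧ ∀ v' ∈ K, ⟪v', x⟫_ℝ = 1 → v' = v := by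
    intro x hx
    obtain ⟨v, hv, hvx, hvu⟩ :=
      existsUnique_limit_functional hNX (h := h) (fun _ => rfl) hr hrh (g := g) (fun _ => rfl)
        hasymp hx
    refine ⟨v, Or.inr (Or.inl hv), hvx, ?_⟩
    rintro v' (rfl | hv' | hv') hv'x
    · simp at hv'x
    · exact hvu v' hv' hv'x
    · have := hJle' x hx v' hv'
      rw [hv'x] at this; norm_num at this
  obtain ⟨B, hBcl, hBconv, hB0, hBC, -, hBK, hBA⟩ :=
    exists_smooth_body hKcompact (mem_insert _ _) hspan isClosed_closure (by
      rintro x hx v (rfl | hv | hv)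
      · simp
      · exact hgle x hx v hv
      · exact (hJle' x hx v hv).trans (by norm_num)) huniq
  obtain ⟨W, hW, hW0, hWC, hWX, hWN⟩ :=
    exists_body_of_subspace_body hspan hBcl hBconv hB0 hBC hBK
  have hcontact : ∀ x : E, (x : EuclideanSpace ℝ (Fin n)) ∈ frontier W ∧
      outerNormal W x = ‖g x‖⁻¹ • (g x : EuclideanSpace ℝ (Fin n)) := by
    intro x
    obtain ⟨ha, hb⟩ := hBA _ (subset_closure (mem_range_self x)) (g x)
      (Or.inr (Or.inl (subset_closure (mem_range_self x)))) (by
        rw [Submodule.inner_orthogonalProjectionOnto_eq_of_mem_left]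
        simp only [hg, hγ]
        rw [real_inner_smul_left]
        exact inv_mul_cancel₀ (hpos x).ne')
    exact hWN x (g x) ha hb
  refine ⟨W, hW, hW0, hWC, fun x hx => (hcontact ⟨x, hx⟩).1, fun x => ?_, hWX⟩
  rw [(hcontact x).2, Submodule.coe_norm]
  simp only [hg, hγ]
  rw [norm_smul, hN1, mul_one, Real.norm_of_nonneg (inv_nonneg.2 (hpos x).le), inv_inv,
    smul_inv_smul₀ (hpos x).ne']

end Main

theorem mainTheorem5 (n : ℕ) (E : Set (EuclideanSpace ℝ (Fin n)))
    (N : E → Metric.sphere (0 : EuclideanSpace ℝ (Fin n)) 1) (hN : Continuous N)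
    (X : Submodule ℝ (EuclideanSpace ℝ (Fin n))) :
    (∃ W : Set (EuclideanSpace ℝ (Fin n)),
      IsConvexBody W ∧ 0 ∈ interior W ∧ IsClassC1 W ∧ E ⊆ frontier W ∧
      (∀ x : E, (N x : EuclideanSpace ℝ (Fin n)) = outerNormal W x) ∧
      X = Submodule.span ℝ (outerNormal W '' frontier W)) ↔
    ((∀ x y : E, ⟪(N y : EuclideanSpace ℝ (Fin n)), (x : EuclideanSpace ℝ (Fin n)) - y⟫_ℝ ≤ 0) ∧
     (∀ x z : ℕ → E,
        Bornology.IsBounded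
          (range fun k => X.orthogonalProjectionOnto (x k : EuclideanSpace ℝ (Fin n))) →
        Tendsto (fun k => ⟪(N (z k) : EuclideanSpace ℝ (Fin n)),
          (x k : EuclideanSpace ℝ (Fin n)) - z k⟫_ℝ) atTop (𝓝 0) →
        Tendsto (fun k => ‖(N (z k) : EuclideanSpace ℝ (Fin n)) - N (x k)‖) atTop (𝓝 0)) ∧
     (0 < ⨅ y : E,
        ((⟪(N y : EuclideanSpace ℝ (Fin n)), (y : EuclideanSpace ℝ (Fin n))⟫_ℝ : ℝ) : EReal)) ∧
     (normalSpan N ≤ X ∧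
       (normalSpan N ≠ X →
         ∃ (w p : Fin (Module.finrank ℝ X - Module.finrank ℝ (normalSpan N)) →
              EuclideanSpace ℝ (Fin n)) (ε : ℝ),
           LinearIndependent ℝ w ∧ (∀ j, ‖w j‖ = 1) ∧ (∀ j, w j ∈ X ⊓ (normalSpan N)ᗮ) ∧
           0 < ε ∧ ε < 1 ∧
           (closure E ∪ {0}) ∩ (⋃ j, projCone (normalSpan N) ε (w j) (p j)) = ∅))) := by
  constructor
  · rintro ⟨W, ⟨hcl, hW, -⟩, h0, hC, hE, hNW, hX⟩
    have hfr : ∀ x : E, (x : EuclideanSpace ℝ (Fin n)) ∈ frontier W := fun x => hE x.2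
    have hYX : normalSpan N ≤ X := by
      rw [normalSpan, Submodule.span_le]
      rintro _ ⟨y, rfl⟩
      simp only [hNW]
      rw [hX]
      exact Submodule.subset_span (mem_image_of_mem _ (hfr y))
    refine ⟨fun x y => ?_, fun x z hb hlim => ?_, ?_, hYX, fun _ => ?_⟩
    · rw [hNW, inner_outerNormal_sub hC hW h0 (hfr y)]
      refine mul_nonpos_of_nonneg_of_nonpos (by positivity) ?_
      have h1 := (hC.gradient_frontier hW h0 (hfr y)).2.2.2 x
      rw [(hC.gradient_frontier hW h0 (hfr x)).1] at h1
      linarith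
    · simp only [hNW] at hlim ⊢
      exact tendsto_norm_outerNormal_sub hC hW h0 hX (fun k => hfr (x k)) (fun k => hfr (z k))
        hb hlim
    · obtain ⟨B, hB0, hB⟩ := hC.exists_norm_gradient_le hW h0
      refine lt_of_lt_of_le (b := ((B⁻¹ : ℝ) : EReal)) (EReal.coe_pos.2 (inv_pos.2 hB0))
        (le_iInf fun y => EReal.coe_le_coe_iff.2 ?_)
      obtain ⟨-, h2, h3, -⟩ := hC.gradient_frontier hW h0 (hfr y)
      rw [hNW, outerNormal, real_inner_smul_left, h2, mul_one]
      exact inv_anti₀ h3 (hB _ (hfr y))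
    · obtain ⟨w, p, ε, hli, hw1, hwX, hε0, hε1, hcone⟩ :=
        exists_projCone_disjoint hC hW h0 hX hYX
      refine ⟨w, p, ε, hli, hw1, hwX, hε0, hε1, ?_⟩
      rw [← disjoint_iff_inter_eq_empty, Set.disjoint_left]
      intro x hx hxV
      obtain ⟨j, hj⟩ := mem_iUnion.1 hxV
      refine hcone j x ?_ hj
      rcases hx with hx | rfl
      · exact closure_minimal (hE.trans hcl.frontier_subset) hcl hx
      · exact interior_subset h0
  · rintro ⟨h1, h2, h3, hYX, h4⟩
    obtain ⟨r, hr, hrh⟩ := EReal.exists_pos_le_of_iInf_pos h3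
    refine exists_body_of_conditions h1 h2 hr hrh hYX fun hne => ?_
    obtain ⟨w, p, ε, hli, -, hwX, hε, -, hemp⟩ := h4 hne
    refine ⟨w, p, ε, hli, hwX, hε, fun j x hx hxV => ?_⟩
    have : x ∈ (closure E ∪ {0}) ∩ (⋃ j, projCone (normalSpan N) ε (w j) (p j)) :=
      ⟨Or.inl (subset_closure hx), mem_iUnion.2 ⟨j, hxV⟩⟩
    rw [hemp] at this
    exact this
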